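/- **Slot assignment.** Let $\Delta\ge 0$ and $B\ge 1$ be integers and let $0\le \alpha_1\le\dots\le\alpha_{\Delta+1}$ be real rates of slots $1,\dots,\Delta+1$. An instance is a finite graph $G=(V,E)$ of maximum degree at most $\Delta$ whose nodes are the agents, where agent $v$ has a private weight $w(v)\in\{1,\dots,B\}$. An assignment $o\colon V\to\{1,\dots,\Delta+1\}$ is feasible if $o(u)\ne o(v)$ for all $\{u,v\}\in E$. Agent $v$ has utility $\alpha_{o(v)}w(v)$, and the quality of $o$ is $u_w(o)=\sum_{v}\alpha_{o(v)}w(v)$. A mechanism maps every bid vector $b\in\{1,\dots,B\}^V$ to an assignment $o(b)$ and payments $p(b)\in\mathbb R^V$; an agent with weight $w(v)$ then has total utility $\alpha_{o(b)(v)}w(v)+p(b)(v)$. We write $(x,b_{-v})$ for $b$ with the bid of $v$ replaced by $x$. **LOCAL model.** Each node initially knows its own identifier and its own bid, together with the common parameters $\Delta$, $B$, $\alpha$ (but not $n=|V|$). The identifiers are distinct and bounded by some polynomial in $n$. In each synchronous round every node sends a message of arbitrary size through each of its ports, receives the messages of its neighbours, and updates its state by an arbitrary function; each node eventually stops with an output.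 The running time is the number of rounds until all nodes have stopped. **Theorem 7.1.** There is a deterministic LOCAL algorithm which, for all $\Delta$, $B$ and $\alpha$ as above and on every such graph, with every assignment of identifiers and port numbers, outputs at each node $v$ the values $o(b)(v)$ and $p(b)(v)$ of a mechanism such that 1. (running time) for every bid vector $b$, all nodes have stopped after $O(\Delta B+\log^* n)$ rounds, where the constant depends only on the polynomial that bounds the identifiers; 2. (incentive compatibility) for every agent $v$, every $b_{-v}$ and every true weight $w(v)\in\{1,\dots,B\}$, the bid $x=w(v)$ maximises the total utility of $v$ under the bids $(x,b_{-v})$ over all $x\in\{1,\dots,B\}$; 3. (monotonicity and payments) the slot of $v$ under the bids $(x,b_{-v})$ is non-decreasing in $x$, and the payments are the multi-threshold Myerson payments: if $c_1<\dots<c_\ell$ are the slots that $v$ obtains under $(x,b_{-v})$ for $x\in\{1,\dots,B\}$, if $b^*_k$ is the smallest $x$ for which $v$ obtains $c_k$, and if $o(b)(v)=c_i$, then $$p(b)(v)=-\sum_{k=1}^{i}(\alpha_{c_k}-\alpha_{c_{k-1}})\,b^*_k,\qquad \alpha_{c_0}:=0;$$ 4. (approximation) for truthful bids $b=w$, the assignment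 $o(w)$ is feasible and is an $O(\Delta)$-approximation: there is an absolute constant $C$ with $u_w(o')\le C\max\{1,\Delta\}\,u_w(o(w))$ for every feasible assignment $o'$. -/

import Mathlib

/-- The iterated logarithm (base two): how often the logarithm has to be applied until the value is
at most one. Rounding the logarithms up does not change this number, since all the bounds it is
compared with (`1, 2, 4, 16, …`) are integers. -/
def logStar (n : ℕ) : ℕ :=
  if h : n ≤ 1 then 0 else logStar (Nat.clog 2 n) + 1
termination_by n
decreasing_by
  have h1 : n - 1 < 2 ^ (n - 1) := Nat.lt_two_pow_self
  have h2 : Nat.clog 2 n ≤ n - 1 := Nat.clog_le_of_le_pow (by omega)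
  omega

/-! ### The LOCAL model -/

/-- A deterministic algorithm for the LOCAL model of synchronous message passing. A node starts
knowing only its identifier and its own input. There is no restriction on the local computation or
on the size of the messages. A node has stopped as soon as `output` of its state is not `none`.

Parameters that are common knowledge enter by letting the algorithm depend on them; the number of
nodes is not one of them. -/
structure LocalAlgorithm (In Out : Type) where
  State : Type
  Msg : Type
  /-- the initial state, from the identifier and the local input -/
  init : ℕ → In → State
  /-- the message sent in the current round through each port -/
  send : State → ℕ → Msg
  /-- the new state, from the old one and the message received through each port (`none` for the
  port numbers that are not connected to an edge) -/
  receive : State → (ℕ → Option Msg) → State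
  output : State → Option Out

/-- The graph `G` as a communication network: nodes have distinct identifiers, and each node `v`
numbers its incident edges by the ports `0, …, deg v - 1`. -/
structure Network {V : Type} [Fintype V] (G : SimpleGraph V) [DecidableRel G.Adj] where
  ident : V → ℕ
  ident_injective : Function.Injective ident
  port : ∀ v : V, G.neighborSet v ≃ Fin (G.degree v)

namespace LocalAlgorithm

variable {In Out V : Type} [Fintype V] {G : SimpleGraph V} [DecidableRel G.Adj]

/-- The messages that arrive at `v`, by port, when the nodes are in the states `s`. -/
def inbox (A : LocalAlgorithm In Out) (N : Network G) (s : V → A.State) (v : V) :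
    ℕ → Option A.Msg :=
  fun p =>
    if h : p < G.degree v then
      let u : G.neighborSet v := (N.port v).symm ⟨p, h⟩
      some (A.send (s u.1) (N.port u.1 ⟨v, G.adj_symm u.2⟩ : Fin (G.degree u.1)))
    else none

/-- The state of each node after `t` rounds. The state of a node that has stopped is final. -/
def state (A : LocalAlgorithm In Out) (N : Network G) (input : V → In) : ℕ → V → A.State
  | 0, v => A.init (N.ident v) (input v)
  | t + 1, v =>
    if (A.output (A.state N input t v)).isSome then A.state N input t v
    else A.receive (A.state N input t v) (A.inbox N (A.state N input t) v)

end LocalAlgorithm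

/-! ### The slot assignment problem and mechanisms for it

The slots are `0, …, Δ`, slot `j` has the rate `α j`, and bids and weights lie in `{1, …, B}`. -/

/-- The profiles of bids (or of weights) with all values in `{1, …, B}`. -/
def ValidBids {V : Type} (B : ℕ) (b : V → ℕ) : Prop :=
  ∀ v, b v ∈ Finset.Icc 1 B

/-- An assignment of slots is feasible if neighbours have different slots. -/
def FeasibleSlots {V : Type} (G : SimpleGraph V) {Δ : ℕ} (o : V → Fin (Δ + 1)) : Prop :=
  ∀ u v, G.Adj u v → o u ≠ o v

/-- The quality of an assignment: the sum of the utilities `α_{o(v)} w(v)` of the agents. -/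
noncomputable def welfare {V : Type} [Fintype V] {Δ : ℕ} (α : Fin (Δ + 1) → ℝ) (w : V → ℕ)
    (o : V → Fin (Δ + 1)) : ℝ :=
  ∑ v, α (o v) * (w v : ℝ)

/-- An allocation rule together with a payment rule, both as functions of the bids. The payment is
added to the utility of the agent, so a negative payment is a price paid by the agent. -/
structure SlotMechanism (V : Type) (Δ : ℕ) where
  slot : (V → ℕ) → V → Fin (Δ + 1)
  pay : (V → ℕ) → V → ℝ

namespace SlotMechanism

variable {V : Type} {Δ : ℕ}

/-- The total utility of agent `v` with true weight `t` when the bids are `b`. -/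
noncomputable def totalUtility (M : SlotMechanism V Δ) (α : Fin (Δ + 1) → ℝ) (v : V) (t : ℕ)
    (b : V → ℕ) : ℝ :=
  α (M.slot b v) * (t : ℝ) + M.pay b v

/-- The local algorithm `A` computes the mechanism on the network `N`: for every profile of bids,
every node has stopped after at most `T` rounds and has output its slot and its payment. -/
def ComputedBy [Fintype V] {G : SimpleGraph V} [DecidableRel G.Adj] (M : SlotMechanism V Δ)
    (B : ℕ) (A : LocalAlgorithm ℕ (Fin (Δ + 1) × ℝ)) (N : Network G) (T : ℕ) : Prop :=
  ∀ b, ValidBids B b → ∀ v, A.output (A.state N b T v) = some (M.slot b v, M.pay b v)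

variable [DecidableEq V]

/-- Whatever the others bid, an agent `v` with true weight `t` maximises its total utility by
bidding `t`. -/
def IncentiveCompatible (M : SlotMechanism V Δ) (B : ℕ) (α : Fin (Δ + 1) → ℝ) : Prop :=
  ∀ b, ValidBids B b → ∀ v, ∀ t ∈ Finset.Icc 1 B, ∀ x ∈ Finset.Icc 1 B,
    M.totalUtility α v t (Function.update b v x) ≤ M.totalUtility α v t (Function.update b v t)

/-- The allocation rule is monotone: with the other bids fixed, a higher bid never leads to a lower
slot. -/
def MonotoneAllocation (M : SlotMechanism V Δ) (B : ℕ) : Prop :=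
  ∀ b, ValidBids B b → ∀ v, ∀ x ∈ Finset.Icc 1 B, ∀ y ∈ Finset.Icc 1 B, x ≤ y →
    M.slot (Function.update b v x) v ≤ M.slot (Function.update b v y) v

/-- The set of slots that `v` obtains with some bid, the other bids being fixed. -/
def possibleSlots (M : SlotMechanism V Δ) (B : ℕ) (b : V → ℕ) (v : V) : Finset (Fin (Δ + 1)) :=
  (Finset.Icc 1 B).image fun x => M.slot (Function.update b v x) v

/-- The critical threshold of the slot `j`: the smallest bid with which `v` obtains `j`, the other
bids being fixed. It is used for possible slots `j` of `v` only. -/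
noncomputable def threshold (M : SlotMechanism V Δ) (B : ℕ) (b : V → ℕ) (v : V)
    (j : Fin (Δ + 1)) : ℕ :=
  sInf {x | x ∈ Finset.Icc 1 B ∧ M.slot (Function.update b v x) v = j}

/-- The rate of the next lower possible slot of `v` below `j`, and `0` if there is none. -/
noncomputable def previousRate (M : SlotMechanism V Δ) (B : ℕ) (α : Fin (Δ + 1) → ℝ) (b : V → ℕ)
    (v : V) (j : Fin (Δ + 1)) : ℝ :=
  if h : ((M.possibleSlots B b v).filter (· < j)).Nonempty then
    α (((M.possibleSlots B b v).filter (· < j)).max' h)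
  else 0

/-- Multi-threshold payments: if `c_1 < … < c_ℓ` are the possible slots of `v`, with critical
thresholds `b*_1, …, b*_ℓ`, and `v` obtains the slot `c_i`, then its payment is
`- ∑_{k ≤ i} (α_{c_k} - α_{c_{k-1}}) b*_k`, where `α_{c_0} = 0`. -/
def ThresholdPayments (M : SlotMechanism V Δ) (B : ℕ) (α : Fin (Δ + 1) → ℝ) : Prop :=
  ∀ b, ValidBids B b → ∀ v,
    M.pay b v = -∑ j ∈ (M.possibleSlots B b v).filter (· ≤ M.slot b v),
      (α j - M.previousRate B α b v j) * (M.threshold B b v j : ℝ)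

end SlotMechanism

/-! Rank the agents by bid, highest first, and break ties by a proper colouring with `numColors Δ`,
that is O(Δ), colours that is computed from the identifiers alone. In this order every agent takes
the highest slot that no neighbour has taken. Neighbours never share a rank, so all agents of one
rank choose in the same round, and `B * numColors Δ` rounds suffice.

Raising a bid only moves the agent ahead, and nothing changes before its new turn, so its slot
cannot drop (`greedySlot_mono`); the others keep their ranks because the colouring ignores bids.
Under threshold payments the utility of an agent of true weight t telescopes to the sum of
(increment of α at j) · (t - threshold of j) over its possible slots j up to the one obtained, and
bidding t keeps precisely the j with threshold at most t (`thresholdPayment_truthful`). For the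
approximation, an agent that would prefer a higher slot has an earlier neighbour of at least its
weight in that slot; every agent is charged by itself and by at most Δ neighbours
(`welfare_le_greedySlot`).

The colouring comes from a Linial-type reduction along towers down to O(Δ²) colours
(`recolor_proper`), followed by 2Δ + 1 rounds with affine codes (`settle_isSome`). Since n is
unknown, stages are counted downwards: the size of an identifier fixes the stage at which its node
joins, and nodes wait for missing values of their neighbours. The running time is then the largest
level, which `poly_le_tower` bounds by log* n plus a constant for the colour reduction. Slots are
carried as functions of the whole bid profile, so a node evaluates its slot for other own bids, and
hence its payment, without further communication (`exists_computedBy`). -/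

/-! ### Staged protocols and their simulation by local algorithms -/

/-- A protocol in stages, counted downwards to stage `0`. A node whose identifier has level `ℓ` holds
its initial value in all stages `j ≥ ℓ`; its value in an earlier numbered stage `j` is computed from
the values of the node and of its neighbours in stage `j + 1`. -/
structure StagedProtocol (In Y Out : Type) where
  level : ℕ → ℕ
  start : ℕ → In → Y
  step : ℕ → Y → Set Y → Y
  out : Y → Out

namespace StagedProtocol

variable {In Y Out V : Type} [Fintype V] {G : SimpleGraph V} [DecidableRel G.Adj]

open Classical in
/-- The local algorithm in which every node stores and sends the values of all stages that it knows
so far, and stops once it knows the value of stage `0`. -/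
noncomputable def toLocal (P : StagedProtocol In Y Out) : LocalAlgorithm In Out where
  State := ℕ → Option Y
  Msg := ℕ → Option Y
  init i x := fun j => if P.level i ≤ j then some (P.start i x) else none
  send s _ := s
  receive s m := fun j =>
    if (s j).isSome then s j
    else if ∀ p f, m p = some f → (f (j + 1)).isSome then
      (s (j + 1)).map fun y => P.step j y {z | ∃ p f, m p = some f ∧ f (j + 1) = some z}
    else none
  output s := (s 0).map P.out

/-- The values `y j v` of all stages `j` at all nodes `v` follow the protocol. -/
def IsRun (P : StagedProtocol In Y Out) (N : Network G) (input : V → In) (y : ℕ → V → Y) : Prop :=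
  ∀ j v, y j v = if P.level (N.ident v) ≤ j then P.start (N.ident v) (input v)
    else P.step j (y (j + 1) v) (y (j + 1) '' G.neighborSet v)

/-- A node sends its whole state through every port, so the port numbering has no influence on the
set of received messages. -/
lemma exists_inbox_iff (P : StagedProtocol In Y Out) (N : Network G)
    (s : V → P.toLocal.State) (v : V) (f : ℕ → Option Y) :
    (∃ p, P.toLocal.inbox N s v p = some f) ↔ ∃ u, G.Adj v u ∧ s u = f := by
  constructor
  · rintro ⟨p, hp⟩
    simp only [LocalAlgorithm.inbox] at hp
    split_ifs at hp with h
    exact ⟨_, ((N.port v).symm ⟨p, h⟩).2, Option.some.inj hp⟩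
  · rintro ⟨u, hu, rfl⟩
    refine ⟨N.port v ⟨u, hu⟩, ?_⟩
    simp only [LocalAlgorithm.inbox, Fin.is_lt, dif_pos, Fin.eta, Equiv.symm_apply_apply]
    rfl

/-- The values of the stages that `v` knows after `t` rounds. -/
noncomputable def known (P : StagedProtocol In Y Out) (N : Network G) (input : V → In) (t : ℕ)
    (v : V) : ℕ → Option Y :=
  P.toLocal.state N input t v

lemma known_zero (P : StagedProtocol In Y Out) (N : Network G) (input : V → In) (v : V) (j : ℕ) :
    P.known N input 0 v j =
      if P.level (N.ident v) ≤ j then some (P.start (N.ident v) (input v)) else none :=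
  rfl

open Classical in
lemma known_succ (P : StagedProtocol In Y Out) (N : Network G) (input : V → In) (t : ℕ) (v : V)
    (j : ℕ) :
    P.known N input (t + 1) v j =
      if (P.known N input t v 0).isSome ∨ (P.known N input t v j).isSome then P.known N input t v j
      else if ∀ u, G.Adj v u → (P.known N input t u (j + 1)).isSome then
        (P.known N input t v (j + 1)).map fun y =>
          P.step j y {z | ∃ u, G.Adj v u ∧ P.known N input t u (j + 1) = some z}
      else none := by
  have hall : (∀ p f, P.toLocal.inbox N (P.known N input t) v p = some f → (f (j + 1)).isSome) ↔
      ∀ u, G.Adj v u → (P.known N input t u (j + 1)).isSome := by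
    constructor
    · intro h u hu
      obtain ⟨p, hp⟩ := (P.exists_inbox_iff N (P.known N input t) v _).2 ⟨u, hu, rfl⟩
      exact h p _ hp
    · intro h p f hp
      obtain ⟨u, hu, rfl⟩ := (P.exists_inbox_iff N _ v f).1 ⟨p, hp⟩
      exact h u hu
  have hset : {z | ∃ p f, P.toLocal.inbox N (P.known N input t) v p = some f ∧
      f (j + 1) = some z} = {z | ∃ u, G.Adj v u ∧ P.known N input t u (j + 1) = some z} := by
    ext z
    constructor
    · rintro ⟨p, f, hp, hf⟩
      obtain ⟨u, hu, rfl⟩ := (P.exists_inbox_iff N _ v f).1 ⟨p, hp⟩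
      exact ⟨u, hu, hf⟩
    · rintro ⟨u, hu, hf⟩
      obtain ⟨p, hp⟩ := (P.exists_inbox_iff N (P.known N input t) v _).2 ⟨u, hu, rfl⟩
      exact ⟨p, _, hp, hf⟩
  by_cases h0 : (P.known N input t v 0).isSome
  · have hs : P.known N input (t + 1) v = P.known N input t v :=
      if_pos (show ((P.known N input t v 0).map P.out).isSome by rwa [Option.isSome_map])
    rw [hs, if_pos (Or.inl h0)]
  · have hs : P.known N input (t + 1) v =
        P.toLocal.receive (P.known N input t v) (P.toLocal.inbox N (P.known N input t) v) :=
      if_neg (show ¬ ((P.known N input t v 0).map P.out).isSome by rwa [Option.isSome_map])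
    refine (congrFun hs j).trans ?_
    change (if (P.known N input t v j).isSome then P.known N input t v j
      else if ∀ p f, P.toLocal.inbox N (P.known N input t) v p = some f → (f (j + 1)).isSome then
        (P.known N input t v (j + 1)).map fun y => P.step j y
          {z | ∃ p f, P.toLocal.inbox N (P.known N input t) v p = some f ∧ f (j + 1) = some z}
      else none) = _
    simp only [hall, hset, h0, false_or, Bool.false_eq_true]

lemma known_mono (P : StagedProtocol In Y Out) (N : Network G) (input : V → In) {t j : ℕ} {v : V}
    (h : (P.known N input t v j).isSome) : (P.known N input (t + 1) v j).isSome := by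
  rw [known_succ, if_pos (Or.inr h)]
  exact h

/-- What a node knows is correct, and it knows all stages above a known one. -/
lemma known_sound (P : StagedProtocol In Y Out) (N : Network G) (input : V → In)
    {y : ℕ → V → Y} (hy : P.IsRun N input y) (t : ℕ) :
    ∀ v j z, P.known N input t v j = some z →
      z = y j v ∧ (P.known N input t v (j + 1)).isSome := by
  induction t with
  | zero =>
    intro v j z h
    rw [known_zero] at h ⊢
    split_ifs at h with hl
    rw [hy j v, if_pos hl, if_pos (by omega)]
    exact ⟨(Option.some.inj h).symm, rfl⟩
  | succ t ih =>
    intro v j z h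
    rw [known_succ] at h
    split_ifs at h with h1 h2
    · exact ⟨(ih v j z h).1, P.known_mono N input (ih v j z h).2⟩
    · obtain ⟨w, hw, rfl⟩ := Option.map_eq_some_iff.1 h
      refine ⟨?_, P.known_mono N input (by rw [hw]; rfl)⟩
      -- Stages from the level upwards are known at time `0` and never forgotten, so a newly
      -- computed stage lies below the level.
      have hlev : ¬ P.level (N.ident v) ≤ j := by
        intro hl
        refine h1 (Or.inr ?_)
        clear h h1 h2 ih hw
        induction t with
        | zero => simp [known_zero, hl]
        | succ t iht => exact P.known_mono N input iht
      rw [hy j v, if_neg hlev, ← (ih v _ w hw).1]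
      congr 1
      ext z
      constructor
      · rintro ⟨u, hu, hz⟩
        exact ⟨u, hu, ((ih u _ z hz).1).symm⟩
      · rintro ⟨u, hu, rfl⟩
        obtain ⟨z, hz⟩ := Option.isSome_iff_exists.1 (h2 u hu)
        exact ⟨u, hu, by rw [hz, (ih u _ z hz).1]⟩

lemma known_isSome_of_le (P : StagedProtocol In Y Out) (N : Network G) (input : V → In)
    {y : ℕ → V → Y} (hy : P.IsRun N input y) (t : ℕ) (v : V) {i j : ℕ} (hij : i ≤ j)
    (hi : (P.known N input t v i).isSome) : (P.known N input t v j).isSome := by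
  induction j, hij using Nat.le_induction with
  | base => exact hi
  | succ j _ ih =>
    obtain ⟨z, hz⟩ := Option.isSome_iff_exists.1 ih
    exact (P.known_sound N input hy t v j z hz).2

/-- After `t` rounds the stages `j ≥ J - t` are known, if `J` bounds all levels. -/
lemma known_isSome (P : StagedProtocol In Y Out) (N : Network G) (input : V → In)
    {y : ℕ → V → Y} (hy : P.IsRun N input y) {J : ℕ} (hJ : ∀ v, P.level (N.ident v) ≤ J) (t : ℕ) :
    ∀ v j, J ≤ j + t → (P.known N input t v j).isSome := by
  induction t with
  | zero =>
    intro v j h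
    have : P.level (N.ident v) ≤ j := (hJ v).trans h
    simp [known_zero, this]
  | succ t ih =>
    intro v j h
    rw [known_succ]
    split_ifs with h1 h2
    · rcases h1 with h1 | h1
      -- A node that has stopped knows stage `0`, hence all stages, so its frozen state still serves
      -- its neighbours.
      · exact P.known_isSome_of_le N input hy t v (Nat.zero_le j) h1
      · exact h1
    · rw [Option.isSome_map]
      exact ih v (j + 1) (by omega)
    · exact absurd (fun u _ => ih u (j + 1) (by omega)) h2

theorem output_eq (P : StagedProtocol In Y Out) (N : Network G) (input : V → In)
    {y : ℕ → V → Y} (hy : P.IsRun N input y) {J t : ℕ} (hJ : ∀ v, P.level (N.ident v) ≤ J)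
    (ht : J ≤ t) (v : V) :
    P.toLocal.output (P.toLocal.state N input t v) = some (P.out (y 0 v)) := by
  obtain ⟨z, hz⟩ := Option.isSome_iff_exists.1 (P.known_isSome N input hy hJ t v 0 (by omega))
  rw [← (P.known_sound N input hy t v 0 z hz).1]
  exact congrArg (Option.map P.out) hz

end StagedProtocol

/-- Downward recursion over stages is well defined if the levels are bounded. -/
lemma exists_stages {V X : Type} [Fintype V] (level : V → ℕ) (start : V → X)
    (step : ℕ → (V → X) → V → X) :
    ∃ x : ℕ → V → X, ∀ j v, x j v = if level v ≤ j then start v else step j (x (j + 1)) v := by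
  classical
  obtain ⟨J, hJ⟩ : ∃ J, ∀ v, level v ≤ J :=
    ⟨Finset.univ.sup level, fun v => Finset.le_sup (Finset.mem_univ v)⟩
  -- `z d` is stage `J - d`; from stage `J` upwards all nodes hold their start values.
  let z : ℕ → V → X := fun d => Nat.rec start
    (fun d y v => if level v ≤ J - (d + 1) then start v else step (J - (d + 1)) y v) d
  refine ⟨fun j => z (J - j), fun j v => ?_⟩
  rcases Nat.lt_or_ge j J with h | h
  · obtain ⟨d, hd⟩ : ∃ d, J - j = d + 1 := ⟨J - j - 1, by omega⟩
    have h1 : J - (j + 1) = d := by omega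
    have h2 : J - (d + 1) = j := by omega
    simp only [hd, h1]
    change (if level v ≤ J - (d + 1) then start v else step (J - (d + 1)) (z d) v) = _
    rw [h2]
  · have h1 : J - j = 0 := by omega
    rw [if_pos ((hJ v).trans h)]
    simp only [h1]
    rfl

/-! ### Polynomial codes over finite fields -/

/-- Reed–Solomon codes over a field with `2 ^ k` elements. -/
lemma exists_code (k d m : ℕ) (hk : k ≠ 0) (hm : m ≤ (2 ^ k) ^ (d + 1)) :
    ∃ f : ℕ → ℕ → ℕ, (∀ a s, f a s < 2 ^ k) ∧ ∀ a < m, ∀ b < m, a ≠ b →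
      ((Finset.range (2 ^ k)).filter fun s => f a s = f b s).card ≤ d := by
  classical
  let F := GaloisField 2 k
  have : Fintype F := Fintype.ofFinite F
  have hF : Fintype.card F = 2 ^ k := by
    rw [← Nat.card_eq_fintype_card]; exact GaloisField.card 2 k hk
  let e : F ≃ Fin (2 ^ k) := Fintype.equivFinOfCardEq hF
  have hc : Fintype.card (Fin m) ≤ Fintype.card (Fin (d + 1) → F) := by
    simpa [hF] using hm
  obtain ⟨ι⟩ := Function.Embedding.nonempty_of_card_le hc
  let p : ℕ → Polynomial F := fun a =>
    if h : a < m then ((Polynomial.degreeLTEquiv F (d + 1)).symm (ι ⟨a, h⟩) : Polynomial F) else 0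
  have hpos : 0 < 2 ^ k := by positivity
  refine ⟨fun a s => if h : s < 2 ^ k then e ((p a).eval (e.symm ⟨s, h⟩)) else 0, ?_, ?_⟩
  · intro a s
    dsimp only
    split_ifs
    · exact Fin.is_lt _
    · exact hpos
  · intro a ha b hb hab
    have hne : p a - p b ≠ 0 := by
      rw [sub_ne_zero]
      simp only [p, ha, hb, dif_pos]
      intro h
      have := ι.injective ((Polynomial.degreeLTEquiv F (d + 1)).symm.injective (Subtype.ext h))
      exact hab (by simpa using this)
    have hdeg : (p a - p b).natDegree ≤ d := by
      have h1 : p a ∈ Polynomial.degreeLT F (d + 1) := by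
        simp only [p, ha, dif_pos]; exact Subtype.prop _
      have h2 : p b ∈ Polynomial.degreeLT F (d + 1) := by
        simp only [p, hb, dif_pos]; exact Subtype.prop _
      have h3 := Polynomial.mem_degreeLT.1 (Submodule.sub_mem _ h1 h2)
      have := (Polynomial.natDegree_lt_iff_degree_lt hne).2 h3
      omega
    -- Positions of agreement inject into the roots of `p a - p b`.
    refine le_trans ?_ ((Multiset.toFinset_card_le _).trans ((Polynomial.card_roots' _).trans hdeg))
    refine Finset.card_le_card_of_injOn
      (fun s => if h : s < 2 ^ k then e.symm ⟨s, h⟩ else 0) ?_ ?_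
    · intro s hs
      obtain ⟨hs1, hs2⟩ := Finset.mem_filter.1 hs
      have hs1 := Finset.mem_range.1 hs1
      simp only [hs1, dif_pos] at hs2 ⊢
      have h4 := e.injective (Fin.ext hs2)
      simp [Polynomial.mem_roots hne, h4]
    · intro s hs s' hs' h
      have hs1 := Finset.mem_range.1 (Finset.mem_filter.1 hs).1
      have hs1' := Finset.mem_range.1 (Finset.mem_filter.1 hs').1
      simp only [hs1, hs1', dif_pos] at h
      simpa using h

/-- Non-constant affine functions over a field with `2 ^ k` elements: two of them agree at most
once, and each of them is injective. -/
lemma exists_affine_code (k m : ℕ) (hk : k ≠ 0) (hm : m ≤ (2 ^ k - 1) * 2 ^ k) :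
    ∃ g : ℕ → ℕ → ℕ, (∀ a s, g a s < 2 ^ k) ∧
      (∀ a < m, ∀ b < m, a ≠ b → ∀ s < 2 ^ k, ∀ t < 2 ^ k, g a s = g b s → g a t = g b t → s = t) ∧
      ∀ a < m, ∀ s < 2 ^ k, ∀ t < 2 ^ k, g a s = g a t → s = t := by
  classical
  let F := GaloisField 2 k
  have : Fintype F := Fintype.ofFinite F
  have hF : Fintype.card F = 2 ^ k := by
    rw [← Nat.card_eq_fintype_card]; exact GaloisField.card 2 k hk
  let e : F ≃ Fin (2 ^ k) := Fintype.equivFinOfCardEq hF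
  -- A code word is a nonzero slope together with an intercept.
  have hc : Fintype.card (Fin m) ≤ Fintype.card (Fˣ × F) := by
    rw [Fintype.card_prod, Fintype.card_units, hF, Fintype.card_fin]
    exact hm
  obtain ⟨ι⟩ := Function.Embedding.nonempty_of_card_le hc
  let p : ℕ → F → F := fun a x => if h : a < m then (ι ⟨a, h⟩).1 * x + (ι ⟨a, h⟩).2 else 0
  have hpos : 0 < 2 ^ k := by positivity
  refine ⟨fun a s => if h : s < 2 ^ k then e (p a (e.symm ⟨s, h⟩)) else 0, ?_, ?_, ?_⟩
  · intro a s
    dsimp only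
    split_ifs
    · exact Fin.is_lt _
    · exact hpos
  · intro a ha b hb hab s hs t ht h1 h2
    simp only [hs, ht, dif_pos] at h1 h2
    have h1 := e.injective (Fin.ext h1)
    have h2 := e.injective (Fin.ext h2)
    simp only [p, ha, hb, dif_pos] at h1 h2
    -- Subtracting the two agreements leaves slope difference times point difference; equal slopes
    -- would force equal intercepts.
    have h3 : (((ι ⟨a, ha⟩).1 : F) - (ι ⟨b, hb⟩).1) * (e.symm ⟨s, hs⟩ - e.symm ⟨t, ht⟩) = 0 := by
      linear_combination h1 - h2
    rcases mul_eq_zero.1 h3 with h | h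
    · exfalso
      have h4 := sub_eq_zero.1 h
      rw [h4] at h1
      have := ι.injective (Prod.ext (Units.ext h4) (add_left_cancel h1))
      exact hab (by simpa using this)
    · simpa using sub_eq_zero.1 h
  · intro a ha s hs t ht h1
    simp only [hs, ht, dif_pos] at h1
    have h1 := e.injective (Fin.ext h1)
    simp only [p, ha, dif_pos] at h1
    have := mul_left_cancel₀ (Units.ne_zero _) (add_right_cancel h1)
    simpa using this

/-! ### Reducing a colouring along codes -/

section Reduction

variable {V : Type} (G : SimpleGraph V)

open Classical in
/-- Each node `v` presents the colour `g v t` in round `t`, until it presents a colour that none of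
its neighbours presents; then it keeps this colour forever. -/
noncomputable def settle (g : V → ℕ → ℕ) : ℕ → V → Option ℕ
  | 0, _ => none
  | t + 1, v =>
    if (settle g t v).isSome then settle g t v
    else if ∀ u, G.Adj v u → (settle g t u).getD (g u t) ≠ g v t then some (g v t)
    else none

variable {G} {g : V → ℕ → ℕ}

lemma settle_mono {t s : ℕ} (h : t ≤ s) {v : V} {c : ℕ} (hc : settle G g t v = some c) :
    settle G g s v = some c := by
  induction s, h using Nat.le_induction with
  | base => exact hc
  | succ s _ ih => simp [settle, ih]

lemma exists_of_settle {t : ℕ} {v : V} {c : ℕ} (hc : settle G g t v = some c) :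
    ∃ s, c = g v s ∧ settle G g (s + 1) v = some c ∧ settle G g s v = none ∧
      ∀ u, G.Adj v u → (settle G g s u).getD (g u s) ≠ c := by
  induction t with
  | zero => simp [settle] at hc
  | succ t ih =>
    by_cases h : (settle G g t v).isSome
    · rw [settle, if_pos h] at hc
      exact ih hc
    · have hc' := hc
      rw [settle, if_neg h] at hc
      split_ifs at hc with h1
      obtain rfl := Option.some.inj hc
      exact ⟨t, rfl, hc', by simpa using h, h1⟩

/-- The neighbour that settles later sees the colour already kept by the other; if both settle in
the same round, each has compared its colour with the one the other presents. -/
lemma settle_ne {t : ℕ} {u v : V} (huv : G.Adj u v) {c c' : ℕ} (hu : settle G g t u = some c)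
    (hv : settle G g t v = some c') : c ≠ c' := by
  obtain ⟨s, -, h1, h2, h3⟩ := exists_of_settle hu
  obtain ⟨s', h0', h1', h2', h3'⟩ := exists_of_settle hv
  rcases lt_trichotomy s s' with h | h | h
  · have := h3' u huv.symm
    rwa [settle_mono h h1] at this
  · subst h
    have := h3 v huv
    rw [h2', Option.getD_none, ← h0'] at this
    exact this.symm
  · have := h3 v huv
    rw [settle_mono h h1'] at this
    exact this.symm

/-- If presented colours of neighbours agree at most once and no node presents a colour twice in the
first `2 Δ + 1` rounds, then all nodes have settled after these rounds. -/
lemma settle_isSome [Fintype V] [DecidableRel G.Adj] {Δ : ℕ} (hΔ : ∀ v, G.degree v ≤ Δ)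
    (h1 : ∀ u v, G.Adj u v → ∀ s < 2 * Δ + 1, ∀ t < 2 * Δ + 1,
      g u s = g v s → g u t = g v t → s = t)
    (h2 : ∀ v, ∀ s < 2 * Δ + 1, ∀ t < 2 * Δ + 1, g v s = g v t → s = t) (v : V) :
    (settle G g (2 * Δ + 1) v).isSome := by
  classical
  by_contra hv
  have hnone : ∀ t ≤ 2 * Δ + 1, settle G g t v = none := by
    intro t ht
    by_contra h
    obtain ⟨c, hc⟩ := Option.ne_none_iff_exists'.1 h
    exact hv (by rw [settle_mono ht hc]; rfl)
  have hex : ∀ t, ∃ u, t < 2 * Δ + 1 → G.Adj v u ∧ (settle G g t u).getD (g u t) = g v t := by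
    intro t
    by_cases ht : t < 2 * Δ + 1
    · have h := hnone (t + 1) ht
      rw [settle, hnone t ht.le] at h
      simp only [Option.isSome_none, Bool.false_eq_true, if_false] at h
      split_ifs at h with h3
      push Not at h3
      obtain ⟨u, hu⟩ := h3
      exact ⟨u, fun _ => hu⟩
    · exact ⟨v, fun h => absurd h ht⟩
  choose u hu using hex
  -- Each round in which `v` fails is blamed on a neighbour and on whether that neighbour is
  -- settled. No such pair is blamed twice: two unsettled clashes are two agreements of codes, and a
  -- settled neighbour has one fixed colour, which `v` presents at most once. This leaves at most 2Δ
  -- failures.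
  have hcard : (Finset.range (2 * Δ + 1)).card ≤
      (G.neighborFinset v ×ˢ (Finset.univ : Finset Bool)).card := by
    refine Finset.card_le_card_of_injOn (fun t => (u t, (settle G g t (u t)).isSome)) ?_ ?_
    · intro t ht
      have := (hu t (by simpa using ht)).1
      exact Finset.mem_coe.2 (Finset.mem_product.2
        ⟨(G.mem_neighborFinset v _).2 this, Finset.mem_univ _⟩)
    · intro s hs t ht hst
      have hs : s < 2 * Δ + 1 := by simpa using hs
      have ht : t < 2 * Δ + 1 := by simpa using ht
      obtain ⟨e1, e2⟩ := Prod.mk.inj hst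
      obtain ⟨ha, hs1⟩ := hu s hs
      obtain ⟨-, ht1⟩ := hu t ht
      rw [← e1] at e2 ht1
      cases hsS : settle G g s (u s) with
      | none =>
        rw [hsS] at e2
        have htS : settle G g t (u s) = none := by
          simpa using e2.symm
        rw [hsS] at hs1
        rw [htS] at ht1
        exact h1 (u s) v ha.symm s hs t ht hs1 ht1
      | some c =>
        rw [hsS] at e2 hs1
        obtain ⟨c', htS⟩ : ∃ c', settle G g t (u s) = some c' :=
          Option.isSome_iff_exists.1 e2.symm
        rw [htS] at ht1
        have hcc : c = c' := by
          rcases le_total s t with h | h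
          · exact Option.some.inj ((settle_mono h hsS).symm.trans htS)
          · exact Option.some.inj (hsS.symm.trans (settle_mono h htS))
        refine h2 v s hs t ht ?_
        rw [← hs1, ← ht1, hcc, Option.getD_some, Option.getD_some]
  simp only [Finset.card_range, Finset.card_product, Finset.card_univ, Fintype.card_bool,
    SimpleGraph.card_neighborFinset_eq_degree] at hcard
  have := hΔ v
  omega

end Reduction

/-! ### Greedy slot assignment in the order of a ranking -/

section Greedy

variable {V : Type} (G : SimpleGraph V) (Δ : ℕ)

open Classical in
/-- The nodes of rank `0, 1, 2, …` choose one after the other the highest slot that no neighbour has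
chosen before; `greedy G Δ r τ v` is the choice of `v` before the turn of rank `τ`. -/
noncomputable def greedy (r : V → ℕ) : ℕ → V → Option (Fin (Δ + 1))
  | 0, _ => none
  | τ + 1, v =>
    if r v = τ then some (sSup {c | ∃ u, G.Adj v u ∧ greedy r τ u = some c}ᶜ) else greedy r τ v

variable {G Δ} {r : V → ℕ}

lemma greedy_eq_none {τ : ℕ} {v : V} (h : τ ≤ r v) : greedy G Δ r τ v = none := by
  induction τ with
  | zero => rfl
  | succ τ ih => rw [greedy, if_neg (by omega), ih (by omega)]

lemma greedy_eq_some {τ : ℕ} {v : V} (h : r v < τ) :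
    greedy G Δ r τ v = some (sSup {c | ∃ u, G.Adj v u ∧ greedy G Δ r (r v) u = some c}ᶜ) := by
  induction τ with
  | zero => omega
  | succ τ ih =>
    rw [greedy]
    split_ifs with h1
    · rw [h1]
    · exact ih (by omega)

/-- The slot chosen by `v`. -/
noncomputable def greedySlot (G : SimpleGraph V) (Δ : ℕ) (r : V → ℕ) (v : V) : Fin (Δ + 1) :=
  sSup {c | ∃ u, G.Adj v u ∧ greedy G Δ r (r v) u = some c}ᶜ

lemma greedy_eq {τ : ℕ} {v : V} (h : r v < τ) :
    greedy G Δ r τ v = some (greedySlot G Δ r v) :=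
  greedy_eq_some h

lemma greedy_eq_some_iff {τ : ℕ} {v : V} {c : Fin (Δ + 1)} :
    greedy G Δ r τ v = some c ↔ r v < τ ∧ greedySlot G Δ r v = c := by
  rcases lt_or_ge (r v) τ with h | h
  · simp [greedy_eq h, h]
  · simp [greedy_eq_none h, h]

lemma greedySlot_eq (v : V) : greedySlot G Δ r v =
    sSup {c | ∃ u, G.Adj v u ∧ r u < r v ∧ greedySlot G Δ r u = c}ᶜ := by
  conv_lhs => rw [greedySlot]
  simp only [greedy_eq_some_iff]

/-- At most Δ neighbours cannot block all Δ + 1 slots, so the supremum is attained and is never the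
default value of an empty set. -/
lemma exists_free [Fintype V] [DecidableRel G.Adj] {v : V} (hv : G.degree v ≤ Δ) :
    ({c | ∃ u, G.Adj v u ∧ r u < r v ∧ greedySlot G Δ r u = c}ᶜ : Set (Fin (Δ + 1))).Nonempty := by
  classical
  by_contra h
  rw [Set.not_nonempty_iff_eq_empty, Set.compl_empty_iff] at h
  have h1 : (Finset.univ : Finset (Fin (Δ + 1))) ⊆
      (G.neighborFinset v).image (greedySlot G Δ r) := by
    intro c _
    have hc : c ∈ {c | ∃ u, G.Adj v u ∧ r u < r v ∧ greedySlot G Δ r u = c} := by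
      rw [h]; exact Set.mem_univ c
    obtain ⟨u, hu, -, rfl⟩ := hc
    exact Finset.mem_image_of_mem _ ((G.mem_neighborFinset v u).2 hu)
  have h2 := (Finset.card_le_card h1).trans Finset.card_image_le
  rw [Finset.card_univ, Fintype.card_fin, SimpleGraph.card_neighborFinset_eq_degree] at h2
  omega

lemma greedySlot_ne [Fintype V] [DecidableRel G.Adj] {u v : V} (hv : G.degree v ≤ Δ)
    (huv : G.Adj v u) (hr : r u < r v) : greedySlot G Δ r u ≠ greedySlot G Δ r v := by
  intro h
  have := (exists_free (r := r) hv).csSup_mem (Set.toFinite _)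
  rw [← greedySlot_eq] at this
  exact this ⟨u, huv, hr, h⟩

/-- A free slot above the chosen one would contradict the greedy choice. This supplies the neighbour
to be charged in the approximation bound. -/
lemma exists_of_greedySlot_lt {v : V} {c : Fin (Δ + 1)} (h : greedySlot G Δ r v < c) :
    ∃ u, G.Adj v u ∧ r u < r v ∧ greedySlot G Δ r u = c := by
  by_contra hc
  rw [greedySlot_eq] at h
  exact absurd (le_sSup (show c ∈ {c | ∃ u, G.Adj v u ∧ r u < r v ∧ greedySlot G Δ r u = c}ᶜ
    from hc)) (not_le.2 h)

/-- Moving `v` ahead in the ranking can only improve its slot. -/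
lemma greedySlot_mono {r' : V → ℕ} {v : V} (hv : r' v ≤ r v) (h : ∀ u, u ≠ v → r' u = r u) :
    greedySlot G Δ r v ≤ greedySlot G Δ r' v := by
  -- Before its new turn `v` acts in neither run, so the runs coincide; waiting for the old turn can
  -- only block more slots.
  have key : ∀ τ ≤ r' v, ∀ u, greedy G Δ r τ u = greedy G Δ r' τ u := by
    intro τ
    induction τ with
    | zero => intro _ u; rfl
    | succ τ ih =>
      intro hτ u
      simp only [greedy, ih (by omega)]
      by_cases huv : u = v
      · subst huv
        rw [if_neg (by omega), if_neg (by omega)]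
      · rw [h u huv]
  refine sSup_le_sSup (Set.compl_subset_compl.2 ?_)
  rintro c ⟨u, hu, hc⟩
  rw [← key _ le_rfl, greedy_eq_some_iff] at hc
  exact ⟨u, hu, greedy_eq_some_iff.2 ⟨hc.1.trans_le hv, hc.2⟩⟩

/-- A charging argument: `v` pays for `o v` itself if it obtained at least this slot, and otherwise
charges the earlier neighbour, of at least its weight, that holds `o v`. -/
lemma welfare_le_greedySlot [Fintype V] [DecidableRel G.Adj] (hΔ : ∀ v, G.degree v ≤ Δ)
    {α : Fin (Δ + 1) → ℝ} (hα : Monotone α) (h0 : ∀ j, 0 ≤ α j) {w : V → ℕ}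
    (hw : ∀ u v, G.Adj v u → r u < r v → w v ≤ w u) (o : V → Fin (Δ + 1)) :
    welfare α w o ≤ (Δ + 1) * welfare α w (greedySlot G Δ r) := by
  classical
  set s := greedySlot G Δ r
  have hnn : ∀ v, 0 ≤ α (s v) * (w v : ℝ) := fun v => mul_nonneg (h0 _) (Nat.cast_nonneg _)
  have h1 : ∀ v, α (o v) * (w v : ℝ) ≤
      α (s v) * (w v : ℝ) + ∑ u ∈ G.neighborFinset v, α (s u) * (w u : ℝ) := by
    intro v
    rcases lt_or_ge (s v) (o v) with h | h
    · obtain ⟨u, hu, hr, hc⟩ := exists_of_greedySlot_lt h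
      have h2 : α (o v) * (w v : ℝ) ≤ α (s u) * (w u : ℝ) := by
        rw [← hc]
        exact mul_le_mul_of_nonneg_left (Nat.cast_le.2 (hw u v hu hr)) (h0 _)
      have h3 := Finset.single_le_sum (f := fun u => α (s u) * (w u : ℝ)) (fun u _ => hnn u)
        ((G.mem_neighborFinset v u).2 hu)
      have := hnn v
      linarith
    · have h2 : α (o v) * (w v : ℝ) ≤ α (s v) * (w v : ℝ) :=
        mul_le_mul_of_nonneg_right (hα h) (Nat.cast_nonneg _)
      have h3 : 0 ≤ ∑ u ∈ G.neighborFinset v, α (s u) * (w u : ℝ) :=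
        Finset.sum_nonneg fun u _ => hnn u
      linarith
  have h2 : ∑ v, ∑ u ∈ G.neighborFinset v, α (s u) * (w u : ℝ) ≤
      Δ * ∑ u, α (s u) * (w u : ℝ) := by
    -- Double counting of ordered adjacent pairs: the value at `u` occurs once for each of its at
    -- most Δ neighbours.
    rw [Finset.sum_comm' (t' := Finset.univ) (s' := fun u => G.neighborFinset u)
      (by simp [SimpleGraph.adj_comm]), Finset.mul_sum]
    refine Finset.sum_le_sum fun u _ => ?_
    rw [Finset.sum_const, SimpleGraph.card_neighborFinset_eq_degree, nsmul_eq_mul]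
    exact mul_le_mul_of_nonneg_right (Nat.cast_le.2 (hΔ u)) (hnn u)
  calc welfare α w o ≤ ∑ v, (α (s v) * (w v : ℝ) +
        ∑ u ∈ G.neighborFinset v, α (s u) * (w u : ℝ)) := Finset.sum_le_sum fun v _ => h1 v
    _ ≤ (Δ + 1) * welfare α w s := by
      rw [Finset.sum_add_distrib, welfare]
      linarith

end Greedy

/-! ### Threshold payments -/

section Payments

variable {Δ : ℕ}

/-- The threshold payment of an agent that obtains the slot `c`, if it obtains the slot `s x` with
the bid `x`. -/
noncomputable def thresholdPayment (B : ℕ) (α : Fin (Δ + 1) → ℝ) (s : ℕ → Fin (Δ + 1))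
    (c : Fin (Δ + 1)) : ℝ :=
  -∑ j ∈ ((Finset.Icc 1 B).image s).filter (· ≤ c),
    (α j - if h : (((Finset.Icc 1 B).image s).filter (· < j)).Nonempty then
      α ((((Finset.Icc 1 B).image s).filter (· < j)).max' h) else 0) *
      (sInf {x | x ∈ Finset.Icc 1 B ∧ s x = j} : ℕ)

/-- The increments of `α` along a finite set of slots telescope. -/
lemma sum_increments (α : Fin (Δ + 1) → ℝ) (S : Finset (Fin (Δ + 1))) :
    ∀ c ∈ S, ∑ j ∈ S.filter (· ≤ c),
      (α j - if h : (S.filter (· < j)).Nonempty then α ((S.filter (· < j)).max' h) else 0) =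
        α c := by
  intro c
  induction c using WellFoundedLT.induction with
  | ind c ih =>
    intro hc
    have h1 : S.filter (· ≤ c) = insert c (S.filter (· < c)) := by
      ext j
      simp only [Finset.mem_filter, Finset.mem_insert, le_iff_lt_or_eq]
      constructor
      · rintro ⟨h1, h2 | h2⟩
        · exact Or.inr ⟨h1, h2⟩
        · exact Or.inl h2
      · rintro (rfl | ⟨h1, h2⟩)
        · exact ⟨hc, Or.inr rfl⟩
        · exact ⟨h1, Or.inl h2⟩
    rw [h1, Finset.sum_insert (by simp)]
    by_cases h : (S.filter (· < c)).Nonempty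
    · rw [dif_pos h]
      set m := (S.filter (· < c)).max' h with hm
      obtain ⟨hm1, hm2⟩ := Finset.mem_filter.1 ((S.filter (· < c)).max'_mem h)
      have h2 : S.filter (· < c) = S.filter (· ≤ m) := by
        ext j
        simp only [Finset.mem_filter]
        refine and_congr_right fun hj => ⟨fun hjc => ?_, fun hjm => lt_of_le_of_lt hjm hm2⟩
        exact Finset.le_max' _ _ (Finset.mem_filter.2 ⟨hj, hjc⟩)
      have := ih m hm2 hm1
      rw [h2, this]
      ring
    · rw [dif_neg h, Finset.not_nonempty_iff_eq_empty.1 h]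
      simp

/-- With a monotone allocation, threshold payments make truthful bidding optimal. -/
lemma thresholdPayment_truthful (B : ℕ) {α : Fin (Δ + 1) → ℝ} (hα : Monotone α)
    (h0 : ∀ j, 0 ≤ α j) {s : ℕ → Fin (Δ + 1)}
    (hs : ∀ x ∈ Finset.Icc 1 B, ∀ y ∈ Finset.Icc 1 B, x ≤ y → s x ≤ s y) {t x : ℕ}
    (ht : t ∈ Finset.Icc 1 B) (hx : x ∈ Finset.Icc 1 B) :
    α (s x) * (t : ℝ) + thresholdPayment B α s (s x) ≤
      α (s t) * (t : ℝ) + thresholdPayment B α s (s t) := by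
  set S := (Finset.Icc 1 B).image s with hS
  set δ : Fin (Δ + 1) → ℝ := fun j =>
    α j - if h : (S.filter (· < j)).Nonempty then α ((S.filter (· < j)).max' h) else 0 with hδ
  set b : Fin (Δ + 1) → ℕ := fun j => sInf {x | x ∈ Finset.Icc 1 B ∧ s x = j} with hb
  have hδ0 : ∀ j, 0 ≤ δ j := by
    intro j
    simp only [hδ]
    split_ifs with h
    · have := (Finset.mem_filter.1 ((S.filter (· < j)).max'_mem h)).2
      have := hα this.le
      linarith
    · have := h0 j
      linarith
  have hbS : ∀ j ∈ S, b j ∈ Finset.Icc 1 B ∧ s (b j) = j := by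
    intro j hj
    obtain ⟨y, hy, hyj⟩ := Finset.mem_image.1 hj
    exact Nat.sInf_mem (s := {x | x ∈ Finset.Icc 1 B ∧ s x = j}) ⟨y, hy, hyj⟩
  -- So the slots up to `s t` are those that contribute nonnegative terms `δ j * (t - b j)`;
  -- overbidding adds nonpositive terms and underbidding drops nonnegative ones.
  have hle : ∀ j ∈ S, (b j ≤ t ↔ j ≤ s t) := by
    intro j hj
    obtain ⟨h1, h2⟩ := hbS j hj
    constructor
    · intro h
      rw [← h2]
      exact hs _ h1 _ ht h
    · intro h
      by_contra hlt
      have h3 := hs _ ht _ h1 (not_le.1 hlt).le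
      rw [h2] at h3
      exact hlt (Nat.sInf_le ⟨ht, le_antisymm h3 h⟩)
  have hutil : ∀ y ∈ Finset.Icc 1 B, α (s y) * (t : ℝ) + thresholdPayment B α s (s y) =
      ∑ j ∈ S.filter (· ≤ s y), δ j * ((t : ℝ) - b j) := by
    intro y hy
    have h1 : thresholdPayment B α s (s y) = -∑ j ∈ S.filter (· ≤ s y), δ j * (b j : ℝ) := rfl
    have h2 : ∑ j ∈ S.filter (· ≤ s y), δ j = α (s y) :=
      sum_increments α S (s y) (Finset.mem_image_of_mem _ hy)
    rw [h1, ← h2, Finset.sum_mul, ← sub_eq_add_neg, ← Finset.sum_sub_distrib]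
    simp only [mul_sub]
  rw [hutil x hx, hutil t ht]
  rcases le_total x t with hxt | hxt
  · refine Finset.sum_le_sum_of_subset_of_nonneg ?_ ?_
    · intro j hj
      rw [Finset.mem_filter] at hj ⊢
      exact ⟨hj.1, hj.2.trans (hs _ hx _ ht hxt)⟩
    · intro j hj _
      obtain ⟨h1, h2⟩ := Finset.mem_filter.1 hj
      have : (b j : ℝ) ≤ t := Nat.cast_le.2 ((hle j h1).2 h2)
      exact mul_nonneg (hδ0 j) (by linarith)
  · have hsub : S.filter (· ≤ s t) ⊆ S.filter (· ≤ s x) := by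
      intro j hj
      rw [Finset.mem_filter] at hj ⊢
      exact ⟨hj.1, hj.2.trans (hs _ ht _ hx hxt)⟩
    rw [← Finset.sum_sdiff hsub]
    have : ∑ j ∈ S.filter (· ≤ s x) \ S.filter (· ≤ s t), δ j * ((t : ℝ) - b j) ≤ 0 := by
      refine Finset.sum_nonpos fun j hj => ?_
      obtain ⟨h1, h2⟩ := Finset.mem_sdiff.1 hj
      have h3 := (Finset.mem_filter.1 h1).1
      have h4 : ¬ b j ≤ t := fun h => h2 (Finset.mem_filter.2 ⟨h3, (hle j h3).1 h⟩)
      have : (t : ℝ) ≤ b j := Nat.cast_le.2 (not_le.1 h4).le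
      exact mul_nonpos_of_nonneg_of_nonpos (hδ0 j) (by linarith)
    linarith

end Payments

namespace SlotMechanism

variable {V : Type} [DecidableEq V] {Δ : ℕ}

/-- The mechanism with a given allocation rule and the threshold payments. -/
noncomputable def ofAllocation (B : ℕ) (α : Fin (Δ + 1) → ℝ)
    (slot : (V → ℕ) → V → Fin (Δ + 1)) : SlotMechanism V Δ where
  slot := slot
  pay b v := thresholdPayment B α (fun x => slot (Function.update b v x) v) (slot b v)

lemma thresholdPayments_ofAllocation (B : ℕ) (α : Fin (Δ + 1) → ℝ)
    (slot : (V → ℕ) → V → Fin (Δ + 1)) : (ofAllocation B α slot).ThresholdPayments B α :=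
  fun _ _ _ => rfl

/-- The map from the own bid to the own slot does not depend on the current own bid, so all
deviations are priced by the same thresholds. -/
lemma incentiveCompatible_ofAllocation (B : ℕ) {α : Fin (Δ + 1) → ℝ} (hα : Monotone α)
    (h0 : ∀ j, 0 ≤ α j) {slot : (V → ℕ) → V → Fin (Δ + 1)}
    (h : (ofAllocation B α slot).MonotoneAllocation B) :
    (ofAllocation B α slot).IncentiveCompatible B α := by
  intro b hb v t ht x hx
  simp only [totalUtility, ofAllocation, Function.update_idem]
  exact thresholdPayment_truthful B hα h0 (h b hb v) ht hx

end SlotMechanism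

/-! ### Towers and the iterated logarithm -/

/-- The tower of twos above `3`. -/
def tower : ℕ → ℕ
  | 0 => 3
  | i + 1 => 2 ^ tower i

lemma tower_strictMono : StrictMono tower :=
  strictMono_nat_of_lt_succ fun _ => Nat.lt_two_pow_self

lemma add_three_le_tower (i : ℕ) : i + 3 ≤ tower i := by
  induction i with
  | zero => exact le_rfl
  | succ i ih =>
    have := tower_strictMono (Nat.lt_succ_self i)
    simp only [Nat.succ_eq_add_one] at this
    omega

lemma le_tower_logStar (n : ℕ) : n ≤ tower (logStar n) := by
  induction n using Nat.strong_induction_on with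
  | _ n ih =>
    rw [logStar]
    split_ifs with h
    · exact h.trans (by simp [tower])
    · have h1 : n - 1 < 2 ^ (n - 1) := Nat.lt_two_pow_self
      have h2 : Nat.clog 2 n ≤ n - 1 := Nat.clog_le_of_le_pow (by omega)
      exact (Nat.le_pow_clog (by norm_num) n).trans
        (Nat.pow_le_pow_right (by norm_num) (ih _ (by omega)))

/-- With `e` a tower above both `n` and `K`, the polynomial is at most `e ^ (e + 1)`, which three
further exponentials absorb. -/
lemma poly_le_tower (K n : ℕ) : K * n ^ K ≤ tower (logStar n + K + 3) := by
  set e := tower (logStar n + K) with he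
  have hn : n ≤ e := (le_tower_logStar n).trans (tower_strictMono.monotone (by omega))
  have hK : K ≤ e := (by omega : K ≤ logStar n + K + 3).trans (add_three_le_tower _)
  have h1 : e < 2 ^ e := Nat.lt_two_pow_self
  have he0 : 1 ≤ e := (by omega : 1 ≤ logStar n + K + 3).trans (add_three_le_tower _)
  have h2 : 2 * e ≤ 2 ^ e := by
    have h3 : e - 1 < 2 ^ (e - 1) := Nat.lt_two_pow_self
    calc 2 * e ≤ 2 * 2 ^ (e - 1) := by omega
      _ = 2 ^ e := by rw [← pow_succ']; congr 1; omega
  calc K * n ^ K ≤ e * e ^ e :=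
        Nat.mul_le_mul hK ((Nat.pow_le_pow_left hn K).trans (Nat.pow_le_pow_right he0 hK))
    _ = e ^ (e + 1) := (pow_succ' e e).symm
    _ ≤ (2 ^ e) ^ (e + 1) := Nat.pow_le_pow_left h1.le _
    _ = 2 ^ (e * (e + 1)) := (pow_mul 2 e (e + 1)).symm
    _ ≤ 2 ^ (2 ^ (2 ^ e)) := by
      refine Nat.pow_le_pow_right (by norm_num) ?_
      calc e * (e + 1) ≤ 2 ^ e * 2 ^ e := Nat.mul_le_mul h1.le h1
        _ = 2 ^ (2 * e) := by rw [← pow_add, two_mul]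
        _ ≤ 2 ^ (2 ^ e) := Nat.pow_le_pow_right (by norm_num) h2
    _ = tower (logStar n + K + 3) := rfl

/-! ### Colour reduction from unbounded identifiers -/

/-- Half the number of colours in stage `i` of the colour reduction. -/
def palette (δ i : ℕ) : ℕ := (2 ^ (δ + tower i)) ^ 2

lemma palette_mono (δ : ℕ) : Monotone (palette δ) := fun _ _ h =>
  Nat.pow_le_pow_left (Nat.pow_le_pow_right (by norm_num)
    (Nat.add_le_add_left (tower_strictMono.monotone h) δ)) 2

lemma tower_lt_palette (δ i : ℕ) : tower i < palette δ i :=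
  calc tower i < 2 ^ tower i := Nat.lt_two_pow_self
    _ ≤ 2 ^ (δ + tower i) := Nat.pow_le_pow_right (by norm_num) (by omega)
    _ ≤ palette δ i := Nat.le_self_pow (by norm_num) _

lemma exists_lt_palette (δ a : ℕ) : ∃ i, a < palette δ i :=
  ⟨a, (by have := add_three_le_tower a; omega : a ≤ tower a).trans_lt (tower_lt_palette δ a)⟩

/-- The agreement bound is chosen so that `2 ^ δ` neighbours together spoil fewer than all `2 ^ (δ +
tower i)` positions. -/
lemma exists_stage_code (δ i : ℕ) :
    ∃ f : ℕ → ℕ → ℕ, (∀ a s, f a s < 2 ^ (δ + tower i)) ∧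
      ∀ a < 2 * palette δ (i + 1), ∀ b < 2 * palette δ (i + 1), a ≠ b →
        ((Finset.range (2 ^ (δ + tower i))).filter fun s => f a s = f b s).card
          ≤ 2 ^ tower i - 1 := by
  have h3 : 3 ≤ tower i := by have := add_three_le_tower i; omega
  have h8 : 8 ≤ 2 ^ tower i := Nat.pow_le_pow_right (n := 2) (by norm_num) h3
  refine exists_code _ _ _ (by omega) ?_
  rw [Nat.sub_add_cancel (by omega), palette, ← pow_mul, ← pow_mul, ← pow_succ']
  -- With T = `tower i` the exponents satisfy 2(δ + 2^T) + 1 ≤ (δ + T)2^T once T ≥ 3, which is why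
  -- the tower starts at `3`.
  refine Nat.pow_le_pow_right (by norm_num) ?_
  change (δ + 2 ^ tower i) * 2 + 1 ≤ _
  nlinarith [Nat.mul_le_mul_left δ h8, Nat.mul_le_mul_right (2 ^ tower i) h3]

noncomputable def stageCode (δ i : ℕ) : ℕ → ℕ → ℕ := (exists_stage_code δ i).choose

/-- The new colour of a node of colour `c` when its neighbours have the colours `S`. -/
noncomputable def recolor (δ i c : ℕ) (S : Set ℕ) : ℕ :=
  let s := sInf {s | s < 2 ^ (δ + tower i) ∧ ∀ c' ∈ S, stageCode δ i c s ≠ stageCode δ i c' s}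
  palette δ i + (s * 2 ^ (δ + tower i) + stageCode δ i c s)

section

variable {V : Type} [Fintype V] {G : SimpleGraph V} [DecidableRel G.Adj] {Δ δ : ℕ}

lemma exists_recolor (hΔ : ∀ v, G.degree v ≤ Δ) (hδ : Δ ≤ 2 ^ δ) {i : ℕ} {c : V → ℕ}
    (hc : ∀ v, c v < 2 * palette δ (i + 1)) (hp : ∀ u v, G.Adj u v → c u ≠ c v) (v : V) :
    ∃ s < 2 ^ (δ + tower i), (∀ u, G.Adj v u → stageCode δ i (c v) s ≠ stageCode δ i (c u) s) ∧
      recolor δ i (c v) (c '' G.neighborSet v) =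
        palette δ i + (s * 2 ^ (δ + tower i) + stageCode δ i (c v) s) := by
  classical
  have hne : {s | s < 2 ^ (δ + tower i) ∧ ∀ c' ∈ c '' G.neighborSet v,
      stageCode δ i (c v) s ≠ stageCode δ i c' s}.Nonempty := by
    by_contra hcon
    rw [Set.not_nonempty_iff_eq_empty] at hcon
    have h1 : Finset.range (2 ^ (δ + tower i)) ⊆ (G.neighborFinset v).biUnion fun u =>
        (Finset.range (2 ^ (δ + tower i))).filter fun s =>
          stageCode δ i (c v) s = stageCode δ i (c u) s := by
      intro s hs
      by_contra h
      have : s ∈ {s | s < 2 ^ (δ + tower i) ∧ ∀ c' ∈ c '' G.neighborSet v,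
          stageCode δ i (c v) s ≠ stageCode δ i c' s} := by
        refine ⟨Finset.mem_range.1 hs, ?_⟩
        rintro _ ⟨u, hu, rfl⟩ he
        exact h (Finset.mem_biUnion.2 ⟨u, (G.mem_neighborFinset v u).2 hu,
          Finset.mem_filter.2 ⟨hs, he⟩⟩)
      rw [hcon] at this
      exact this
    have h2 := (Finset.card_le_card h1).trans (Finset.card_biUnion_le_card_mul _ _
      (2 ^ tower i - 1) fun u hu => (exists_stage_code δ i).choose_spec.2 _ (hc v) _ (hc u)
        (hp v u ((G.mem_neighborFinset v u).1 hu)))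
    rw [Finset.card_range, SimpleGraph.card_neighborFinset_eq_degree] at h2
    have h3 : G.degree v * (2 ^ tower i - 1) ≤ 2 ^ δ * (2 ^ tower i - 1) :=
      Nat.mul_le_mul_right _ ((hΔ v).trans hδ)
    have h4 : 2 ^ δ * (2 ^ tower i - 1) < 2 ^ δ * 2 ^ tower i :=
      Nat.mul_lt_mul_of_pos_left (Nat.sub_lt (by positivity) one_pos) (by positivity)
    rw [pow_add] at h2
    omega
  obtain ⟨h1, h2⟩ := Nat.sInf_mem hne
  exact ⟨_, h1, fun u hu => h2 _ ⟨u, hu, rfl⟩, rfl⟩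

/-- Identifiers below `palette δ i` are kept as colours until stage `i`, the other nodes are
recoloured. This gives proper colourings with `2 * palette δ i` colours. -/
lemma recolor_proper (hΔ : ∀ v, G.degree v ≤ Δ) (hδ : Δ ≤ 2 ^ δ) {ident : V → ℕ}
    (hid : Function.Injective ident) {c : ℕ → V → ℕ}
    (hc : ∀ i v, c i v = if ident v < palette δ i then ident v
      else recolor δ i (c (i + 1) v) (c (i + 1) '' G.neighborSet v)) {J : ℕ}
    (hJ : ∀ v, ident v < palette δ J) (i : ℕ) :
    (∀ v, c i v < 2 * palette δ i) ∧ ∀ u v, G.Adj u v → c i u ≠ c i v := by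
  suffices h : ∀ d i, J ≤ i + d →
      (∀ v, c i v < 2 * palette δ i) ∧ ∀ u v, G.Adj u v → c i u ≠ c i v from h J i (by omega)
  intro d
  induction d with
  | zero =>
    intro i hi
    have h1 : ∀ v, c i v = ident v := fun v => by
      rw [hc, if_pos ((hJ v).trans_le (palette_mono δ (show J ≤ i from hi)))]
    refine ⟨fun v => ?_, fun u v huv => ?_⟩
    · have := (hJ v).trans_le (palette_mono δ (show J ≤ i from hi))
      rw [h1]
      omega
    · rw [h1, h1]
      exact fun h => huv.ne (hid h)
  | succ d ih =>
    intro i hi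
    obtain ⟨h1, h2⟩ := ih (i + 1) (by omega)
    have hlt : ∀ a s, stageCode δ i a s < 2 ^ (δ + tower i) :=
      (exists_stage_code δ i).choose_spec.1
    have hpal : palette δ i = 2 ^ (δ + tower i) * 2 ^ (δ + tower i) := sq _
    refine ⟨fun v => ?_, fun u v huv => ?_⟩
    · rw [hc]
      split_ifs with h
      · omega
      · obtain ⟨s, hs, -, he⟩ := exists_recolor hΔ hδ h1 h2 v
        have h3 := hlt (c (i + 1) v) s
        rw [he, hpal]
        have := Nat.mul_le_mul_right (2 ^ (δ + tower i)) (Nat.succ_le_of_lt hs)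
        rw [Nat.succ_mul] at this
        omega
    · rw [hc i u, hc i v]
      obtain ⟨s, hs, hsu, he⟩ := exists_recolor hΔ hδ h1 h2 u
      obtain ⟨s', hs', -, he'⟩ := exists_recolor hΔ hδ h1 h2 v
      split_ifs with h h' h'
      · exact fun h => huv.ne (hid h)
      · rw [he']; omega
      · rw [he]; omega
      · rw [he, he']
        intro h3
        have h3 := Nat.add_left_cancel h3
        have hpos : 0 < 2 ^ (δ + tower i) := by positivity
        -- A new colour encodes a position and the code value there. Equal colours give equal
        -- positions and equal values, against the choice of the position. Recoloured nodes lie in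
        -- the upper half of the palette and thus avoid kept identifiers.
        have hd := congrArg (· / 2 ^ (δ + tower i)) h3
        have hm := congrArg (· % 2 ^ (δ + tower i)) h3
        simp only [Nat.mul_add_mod_self_right, Nat.mod_eq_of_lt (hlt _ _)] at hm
        simp only [Nat.add_comm (_ * _), Nat.add_mul_div_right _ _ hpos,
          Nat.div_eq_of_lt (hlt _ _), Nat.zero_add] at hd
        subst hd
        exact hsu v huv hm

end

lemma exists_final_code (δ : ℕ) :
    ∃ g : ℕ → ℕ → ℕ, (∀ a s, g a s < 2 ^ (δ + 5)) ∧
      (∀ a < 2 * palette δ 0, ∀ b < 2 * palette δ 0, a ≠ b →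
        ∀ s < 2 ^ (δ + 5), ∀ t < 2 ^ (δ + 5), g a s = g b s → g a t = g b t → s = t) ∧
      ∀ a < 2 * palette δ 0, ∀ s < 2 ^ (δ + 5), ∀ t < 2 ^ (δ + 5), g a s = g a t → s = t := by
  refine exists_affine_code _ _ (by omega) ?_
  have h1 : 1 ≤ 2 ^ δ := Nat.one_le_two_pow
  simp only [palette, tower, pow_add]
  rw [Nat.sub_mul]
  refine Nat.le_sub_of_add_le ?_
  nlinarith

noncomputable def finalCode (δ : ℕ) : ℕ → ℕ → ℕ := (exists_final_code δ).choose

/-! ### The protocol for slot assignment -/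

/-- What a node knows about itself in a stage of the protocol. The slot is known as a function of the
bids of all identifiers. -/
structure SlotRecord (Δ : ℕ) where
  ident : ℕ
  color : ℕ
  settled : Option ℕ
  slot : (ℕ → ℕ) → Option (Fin (Δ + 1))

/-- The number of colours that are used in the ranking is `2 ^ (Nat.clog 2 Δ + 5)`. -/
def numColors (Δ : ℕ) : ℕ := 2 ^ (Nat.clog 2 Δ + 5)

/-- The number of stages for colours below `2 * palette _ 0` and for the greedy assignment. -/
def numStages (Δ B : ℕ) : ℕ := B * numColors Δ + (2 * Δ + 1)

-- Stages run downwards through three phases: colour reduction with index `j - numStages Δ B`, then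
-- `2 * Δ + 1` rounds of settling numbered `numStages Δ B - (j + 1)`, then the greedy turns `B *
-- numColors Δ - (j + 1)`. The slot is updated for all bid profiles at once.
open Classical in
noncomputable def SlotRecord.advance {Δ : ℕ} (B j : ℕ) (y : SlotRecord Δ)
    (S : Set (SlotRecord Δ)) : SlotRecord Δ :=
  if numStages Δ B ≤ j then
    { y with color := recolor (Nat.clog 2 Δ) (j - numStages Δ B) y.color (SlotRecord.color '' S) }
  else if B * numColors Δ ≤ j then
    let g := fun z : SlotRecord Δ => finalCode (Nat.clog 2 Δ) z.color (numStages Δ B - (j + 1))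
    { y with settled := if y.settled.isSome then y.settled
        else if ∀ z ∈ S, z.settled.getD (g z) ≠ g y then some (g y) else none }
  else
    { y with slot := fun β =>
        if (B - β y.ident) * numColors Δ + y.settled.getD 0 = B * numColors Δ - (j + 1) then
          some (sSup {c | ∃ z ∈ S, z.slot β = some c}ᶜ)
        else y.slot β }

open Classical in
/-- The number of stages before which a node is recoloured. -/
noncomputable def recolorLevel (δ i : ℕ) : ℕ := Nat.find (exists_lt_palette δ i)

lemma recolorLevel_le_iff {δ i l : ℕ} : recolorLevel δ i ≤ l ↔ i < palette δ l := by
  classical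
  rw [recolorLevel, Nat.find_le_iff]
  exact ⟨fun ⟨m, hm, h⟩ => h.trans_le (palette_mono δ hm), fun h => ⟨l, le_rfl, h⟩⟩

open Classical in
/-- The bids that are known from a set of pairs of identifiers and bids. -/
noncomputable def lookup (K : Set (ℕ × ℕ)) (i : ℕ) : ℕ :=
  if h : ∃ b, (i, b) ∈ K then h.choose else 1

/-- Besides the record, a node keeps the set of all bids that it knows, with their identifiers. -/
noncomputable def slotProtocol (Δ B : ℕ) (α : Fin (Δ + 1) → ℝ) :
    StagedProtocol ℕ (SlotRecord Δ × Set (ℕ × ℕ)) (Fin (Δ + 1) × ℝ) where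
  level i := numStages Δ B + recolorLevel (Nat.clog 2 Δ) i
  start i b := (⟨i, i, none, fun _ => none⟩, {(i, b)})
  step j y S := (y.1.advance B j (Prod.fst '' S), y.2 ∪ ⋃ z ∈ S, z.2)
  out y :=
    ((y.1.slot (lookup y.2)).getD 0,
      thresholdPayment B α
        (fun x => (y.1.slot (Function.update (lookup y.2) y.1.ident x)).getD 0)
        ((y.1.slot (lookup y.2)).getD 0))

/-- An induction over stages from a bound of the levels down to stage `0`. -/
lemma stage_induction {p : ℕ → Prop} (J : ℕ) (h : ∀ j, J ≤ j → p j)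
    (hs : ∀ j, p (j + 1) → p j) (j : ℕ) : p j := by
  suffices h' : ∀ d j, J ≤ j + d → p j from h' J j (by omega)
  intro d
  induction d with
  | zero => exact fun j hj => h j hj
  | succ d ih => exact fun j hj => hs j (ih (j + 1) (by omega))

/-! ### Correctness of the three phases -/

section Run

variable {V : Type} {G : SimpleGraph V} {Δ B : ℕ} {ident : V → ℕ} {x : ℕ → V → SlotRecord Δ}

/-- The records `x j v` of all stages follow the protocol. -/
def IsRecordRun (G : SimpleGraph V) (B : ℕ) (ident : V → ℕ) (x : ℕ → V → SlotRecord Δ) : Prop :=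
  ∀ j v, x j v = if numStages Δ B + recolorLevel (Nat.clog 2 Δ) (ident v) ≤ j then
      ⟨ident v, ident v, none, fun _ => none⟩
    else (x (j + 1) v).advance B j (x (j + 1) '' G.neighborSet v)

lemma IsRecordRun.ident_eq [Fintype V] (hx : IsRecordRun G B ident x) (j : ℕ) :
    ∀ v, (x j v).ident = ident v := by
  refine stage_induction (p := fun j => ∀ v, (x j v).ident = ident v) (Finset.univ.sup fun v =>
    numStages Δ B + recolorLevel (Nat.clog 2 Δ) (ident v)) (fun j hj v => ?_) (fun j ih v => ?_) j
  · rw [hx, if_pos ((Finset.le_sup (f := fun v =>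
      numStages Δ B + recolorLevel (Nat.clog 2 Δ) (ident v)) (Finset.mem_univ v)).trans hj)]
  · rw [hx]
    split_ifs with h1
    · rfl
    · rw [SlotRecord.advance]
      split_ifs <;> exact ih v

lemma IsRecordRun.settled_eq_none [Fintype V] (hx : IsRecordRun G B ident x) (j : ℕ) :
    numStages Δ B ≤ j → ∀ v, (x j v).settled = none := by
  refine stage_induction (p := fun j => numStages Δ B ≤ j → ∀ v, (x j v).settled = none)
    (Finset.univ.sup fun v => numStages Δ B + recolorLevel (Nat.clog 2 Δ) (ident v))
    (fun j hj _ v => ?_) (fun j ih hj v => ?_) j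
  · rw [hx, if_pos ((Finset.le_sup (f := fun v =>
      numStages Δ B + recolorLevel (Nat.clog 2 Δ) (ident v)) (Finset.mem_univ v)).trans hj)]
  · rw [hx]
    split_ifs with h1
    · rfl
    · rw [SlotRecord.advance, if_pos hj]
      exact ih (by omega) v

lemma IsRecordRun.slot_eq_none [Fintype V] (hx : IsRecordRun G B ident x) (j : ℕ) :
    B * numColors Δ ≤ j → ∀ v β, (x j v).slot β = none := by
  refine stage_induction (p := fun j => B * numColors Δ ≤ j → ∀ v β, (x j v).slot β = none)
    (Finset.univ.sup fun v => numStages Δ B + recolorLevel (Nat.clog 2 Δ) (ident v))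
    (fun j hj _ v β => ?_) (fun j ih hj v β => ?_) j
  · rw [hx, if_pos ((Finset.le_sup (f := fun v =>
      numStages Δ B + recolorLevel (Nat.clog 2 Δ) (ident v)) (Finset.mem_univ v)).trans hj)]
  · rw [hx]
    split_ifs with h1
    · rfl
    · rw [SlotRecord.advance]
      split_ifs <;> exact ih (by omega) v β

variable [Fintype V] [DecidableRel G.Adj]

lemma IsRecordRun.color_proper (hx : IsRecordRun G B ident x) (hid : Function.Injective ident)
    (hΔ : ∀ v, G.degree v ≤ Δ) :
    (∀ v, (x (numStages Δ B) v).color < 2 * palette (Nat.clog 2 Δ) 0) ∧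
      ∀ u v, G.Adj u v → (x (numStages Δ B) u).color ≠ (x (numStages Δ B) v).color := by
  refine recolor_proper (c := fun i v => (x (numStages Δ B + i) v).color)
    (J := Finset.univ.sup fun v => recolorLevel (Nat.clog 2 Δ) (ident v)) hΔ
    (Nat.le_pow_clog (by norm_num) Δ) hid ?_ ?_ 0
  · intro i v
    have himg : SlotRecord.color '' (x (numStages Δ B + i + 1) '' G.neighborSet v) =
        (fun v => (x (numStages Δ B + (i + 1)) v).color) '' G.neighborSet v := by
      rw [Set.image_image]
      rfl
    have hlev : numStages Δ B + recolorLevel (Nat.clog 2 Δ) (ident v) ≤ numStages Δ B + i ↔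
        ident v < palette (Nat.clog 2 Δ) i := by
      rw [Nat.add_le_add_iff_left, recolorLevel_le_iff]
    by_cases h : ident v < palette (Nat.clog 2 Δ) i
    · rw [hx, if_pos (hlev.2 h), if_pos h]
    · rw [hx, if_neg (mt hlev.1 h), if_neg h, SlotRecord.advance, if_pos (by omega)]
      simp only [Nat.add_sub_cancel_left, himg]
      rfl
  · intro v
    exact recolorLevel_le_iff.1
      (Finset.le_sup (f := fun v => recolorLevel (Nat.clog 2 Δ) (ident v)) (Finset.mem_univ v))

omit [DecidableRel G.Adj] in
lemma IsRecordRun.settled_eq (hx : IsRecordRun G B ident x) {t : ℕ} (ht : t ≤ 2 * Δ + 1) :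
    ∀ v, (x (numStages Δ B - t) v).color = (x (numStages Δ B) v).color ∧
      (x (numStages Δ B - t) v).settled =
        settle G (fun v => finalCode (Nat.clog 2 Δ) (x (numStages Δ B) v).color) t v := by
  induction t with
  | zero => exact fun v => ⟨rfl, hx.settled_eq_none _ le_rfl v⟩
  | succ t ih =>
    intro v
    have ih := ih (by omega)
    have hS : numStages Δ B = B * numColors Δ + (2 * Δ + 1) := rfl
    obtain ⟨j, hj⟩ : ∃ j, numStages Δ B - (t + 1) = j := ⟨_, rfl⟩
    have h1 : numStages Δ B - t = j + 1 := by omega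
    have h2 : numStages Δ B - (j + 1) = t := by omega
    rw [h1] at ih
    rw [hj, hx, if_neg (by omega), SlotRecord.advance, if_neg (by omega), if_pos (by omega), h2]
    refine ⟨(ih v).1, ?_⟩
    rw [settle]
    simp only [(ih v).1, (ih v).2]
    congr 1
    refine @if_congr _ _ _ (_) (_) _ _ _ _ ?_ rfl rfl
    simp only [Set.forall_mem_image, SimpleGraph.mem_neighborSet, (ih _).1, (ih _).2]

/-- The colour of a node in the ranking. -/
noncomputable def rankColor (Δ B : ℕ) (x : ℕ → V → SlotRecord Δ) (v : V) : ℕ :=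
  (x (B * numColors Δ) v).settled.getD 0

/-- The O(Δ²) colours left by the reduction index affine code words with `numColors Δ` values, and
`2 * Δ + 1` of their positions are enough to settle every node. -/
lemma IsRecordRun.rankColor_proper (hx : IsRecordRun G B ident x)
    (hid : Function.Injective ident) (hΔ : ∀ v, G.degree v ≤ Δ) :
    (∀ v, rankColor Δ B x v < numColors Δ) ∧
      ∀ u v, G.Adj u v → rankColor Δ B x u ≠ rankColor Δ B x v := by
  obtain ⟨hc, hp⟩ := hx.color_proper hid hΔ
  obtain ⟨hg1, hg2, hg3⟩ := (exists_final_code (Nat.clog 2 Δ)).choose_spec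
  have hlt : 2 * Δ + 1 ≤ 2 ^ (Nat.clog 2 Δ + 5) := by
    have := Nat.le_pow_clog (b := 2) (by norm_num) Δ
    have h1 : 1 ≤ 2 ^ Nat.clog 2 Δ := Nat.one_le_two_pow
    rw [pow_add]
    omega
  have hsome := settle_isSome (g := fun v => finalCode (Nat.clog 2 Δ) (x (numStages Δ B) v).color)
    hΔ (fun u v huv s hs t ht => hg2 _ (hc u) _ (hc v) (hp u v huv) s (hs.trans_le hlt) t
      (ht.trans_le hlt))
    (fun v s hs t ht => hg3 _ (hc v) s (hs.trans_le hlt) t (ht.trans_le hlt))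
  have hS : numStages Δ B - (2 * Δ + 1) = B * numColors Δ := by
    rw [numStages]; omega
  have hset := fun v => (hx.settled_eq le_rfl v).2
  rw [hS] at hset
  refine ⟨fun v => ?_, fun u v huv => ?_⟩
  · obtain ⟨c, hc⟩ := Option.isSome_iff_exists.1 (hsome v)
    obtain ⟨s, rfl, -⟩ := exists_of_settle hc
    rw [rankColor, hset, hc]
    exact hg1 _ _
  · obtain ⟨c, hc⟩ := Option.isSome_iff_exists.1 (hsome u)
    obtain ⟨c', hc'⟩ := Option.isSome_iff_exists.1 (hsome v)
    rw [rankColor, rankColor, hset, hset, hc, hc']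
    exact settle_ne huv hc hc'

/-- Higher bids come first; nodes with the same bid are ordered by their colours. -/
noncomputable def slotRank (Δ B : ℕ) (χ : V → ℕ) (b : V → ℕ) (v : V) : ℕ :=
  (B - b v) * numColors Δ + χ v

omit [DecidableRel G.Adj] in
lemma IsRecordRun.slot_eq (hx : IsRecordRun G B ident x) (β : ℕ → ℕ) {τ : ℕ}
    (hτ : τ ≤ B * numColors Δ) :
    ∀ v, (x (B * numColors Δ - τ) v).settled = (x (B * numColors Δ) v).settled ∧
      (x (B * numColors Δ - τ) v).slot β =
        greedy G Δ (slotRank Δ B (rankColor Δ B x) (β ∘ ident)) τ v := by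
  induction τ with
  | zero => exact fun v => ⟨rfl, hx.slot_eq_none _ le_rfl v β⟩
  | succ τ ih =>
    intro v
    have ih := ih (by omega)
    have hS : numStages Δ B = B * numColors Δ + (2 * Δ + 1) := rfl
    have h1 : B * numColors Δ - (τ + 1) + 1 = B * numColors Δ - τ := by omega
    have h2 : B * numColors Δ - (B * numColors Δ - τ) = τ := by omega
    rw [hx, if_neg (by omega), SlotRecord.advance, if_neg (by omega), if_neg (by omega)]
    simp only [h1, h2]
    refine ⟨(ih v).1, ?_⟩
    rw [greedy]
    simp only [Set.exists_mem_image, SimpleGraph.mem_neighborSet, (ih _).1, (ih _).2,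
      hx.ident_eq, slotRank, rankColor, Function.comp_apply]
    exact if_congr Iff.rfl rfl rfl

omit [DecidableRel G.Adj] in
/-- A slot depends only on the bids that have arrived at the node. -/
lemma IsRecordRun.slot_congr (hx : IsRecordRun G B ident x) {b : V → ℕ}
    {K : ℕ → V → Set (ℕ × ℕ)}
    (hK : ∀ j v, K j v =
      if numStages Δ B + recolorLevel (Nat.clog 2 Δ) (ident v) ≤ j then {(ident v, b v)}
      else K (j + 1) v ∪ ⋃ u ∈ G.neighborSet v, K (j + 1) u) (j : ℕ) :
    ∀ v, (∀ i c, (i, c) ∈ K j v → ∃ w, ident w = i ∧ b w = c) ∧ (ident v, b v) ∈ K j v ∧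
      ∀ β β' : ℕ → ℕ, (∀ i c, (i, c) ∈ K j v → β i = β' i) →
        (x j v).slot β = (x j v).slot β' := by
  have hstart : ∀ j v, numStages Δ B + recolorLevel (Nat.clog 2 Δ) (ident v) ≤ j →
      (∀ i c, (i, c) ∈ K j v → ∃ w, ident w = i ∧ b w = c) ∧ (ident v, b v) ∈ K j v ∧
      ∀ β β' : ℕ → ℕ, (∀ i c, (i, c) ∈ K j v → β i = β' i) →
        (x j v).slot β = (x j v).slot β' := by
    intro j v hj
    rw [hK, if_pos hj, hx, if_pos hj]
    refine ⟨fun i c h => ?_, rfl, fun _ _ _ => rfl⟩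
    obtain ⟨rfl, rfl⟩ := Prod.mk.inj (Set.mem_singleton_iff.1 h)
    exact ⟨v, rfl, rfl⟩
  refine stage_induction (p := fun j => ∀ v,
      (∀ i c, (i, c) ∈ K j v → ∃ w, ident w = i ∧ b w = c) ∧ (ident v, b v) ∈ K j v ∧
      ∀ β β' : ℕ → ℕ, (∀ i c, (i, c) ∈ K j v → β i = β' i) → (x j v).slot β = (x j v).slot β')
    (Finset.univ.sup fun v => numStages Δ B + recolorLevel (Nat.clog 2 Δ) (ident v))
    (fun j hj v => ?_) (fun j ih v => ?_) j
  · exact hstart j v ((Finset.le_sup (f := fun v =>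
      numStages Δ B + recolorLevel (Nat.clog 2 Δ) (ident v)) (Finset.mem_univ v)).trans hj)
  · by_cases h1 : numStages Δ B + recolorLevel (Nat.clog 2 Δ) (ident v) ≤ j
    · exact hstart j v h1
    rw [hK j v, if_neg h1]
    refine ⟨fun i c h => ?_, Or.inl (ih v).2.1, fun β β' h => ?_⟩
    · rcases h with h | h
      · exact (ih v).1 i c h
      · obtain ⟨u, -, hu⟩ := Set.mem_iUnion₂.1 h
        exact (ih u).1 i c hu
    · have hv := (ih v).2.2 β β' fun i c hi => h i c (Or.inl hi)
      have hu : ∀ u ∈ G.neighborSet v, (x (j + 1) u).slot β = (x (j + 1) u).slot β' :=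
        fun u hu => (ih u).2.2 β β' fun i c hi => h i c (Or.inr (Set.mem_iUnion₂.2 ⟨u, hu, hi⟩))
      -- The own bid decides the turn of `v`, hence the invariant that its own pair is always in
      -- `K`.
      have hi : β (ident v) = β' (ident v) := h _ _ (Or.inl (ih v).2.1)
      have hset : {c | ∃ z ∈ x (j + 1) '' G.neighborSet v, z.slot β = some c} =
          {c | ∃ z ∈ x (j + 1) '' G.neighborSet v, z.slot β' = some c} := by
        ext c
        simp only [Set.exists_mem_image]
        exact exists_congr fun u => and_congr_right fun h => by rw [hu u h]
      rw [hx j v, if_neg h1, SlotRecord.advance]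
      by_cases c1 : numStages Δ B ≤ j
      · rw [if_pos c1]
        exact hv
      rw [if_neg c1]
      by_cases c2 : B * numColors Δ ≤ j
      · rw [if_pos c2]
        exact hv
      rw [if_neg c2]
      simp only [hx.ident_eq]
      rw [hi, hv, hset]

end Run

lemma lookup_eq {V : Type} {ident : V → ℕ} (hid : Function.Injective ident) {b : V → ℕ}
    {K : Set (ℕ × ℕ)} (hK : ∀ i c, (i, c) ∈ K → ∃ w, ident w = i ∧ b w = c) {i c : ℕ}
    (h : (i, c) ∈ K) : lookup K i = Function.extend ident b 1 i := by
  have hex : ∃ c, (i, c) ∈ K := ⟨c, h⟩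
  rw [lookup, dif_pos hex]
  obtain ⟨w, rfl, hw⟩ := hK _ _ hex.choose_spec
  rw [hid.extend_apply, hw]

section Mechanism

variable {V : Type} [Fintype V] [DecidableEq V] {G : SimpleGraph V} [DecidableRel G.Adj] {Δ B : ℕ}

/-- The protocol computes, within a number of rounds that bounds the levels of all nodes, the
greedy assignment for a ranking by bids and by a proper colouring that does not depend on bids. -/
lemma exists_computedBy (α : Fin (Δ + 1) → ℝ) (hΔ : ∀ v, G.degree v ≤ Δ) (N : Network G) {T : ℕ}
    (hT : ∀ v, (slotProtocol Δ B α).level (N.ident v) ≤ T) :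
    ∃ χ : V → ℕ, (∀ v, χ v < numColors Δ) ∧ (∀ u v, G.Adj u v → χ u ≠ χ v) ∧
      (SlotMechanism.ofAllocation B α fun (b : V → ℕ) (v : V) =>
        (greedy G Δ (slotRank Δ B χ b) (B * numColors Δ) v).getD 0).ComputedBy B
          (slotProtocol Δ B α).toLocal N T := by
  -- The records do not involve the actual bids, so a single run, and a single colouring, serves all
  -- bid profiles; only the sets `K` below depend on `b`.
  obtain ⟨x, hx⟩ : ∃ x : ℕ → V → SlotRecord Δ, IsRecordRun G B N.ident x :=
    exists_stages (X := SlotRecord Δ)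
      (fun v => numStages Δ B + recolorLevel (Nat.clog 2 Δ) (N.ident v))
      (fun v => ⟨N.ident v, N.ident v, none, fun _ => none⟩)
      fun j y v => (y v).advance B j (y '' G.neighborSet v)
  obtain ⟨h1, h2⟩ := hx.rankColor_proper N.ident_injective hΔ
  refine ⟨rankColor Δ B x, h1, h2, fun b _ v => ?_⟩
  obtain ⟨K, hK⟩ := exists_stages
    (fun v => numStages Δ B + recolorLevel (Nat.clog 2 Δ) (N.ident v))
    (fun v => ({(N.ident v, b v)} : Set (ℕ × ℕ)))
    fun _ k v => k v ∪ ⋃ u ∈ G.neighborSet v, k u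
  have hrun : (slotProtocol Δ B α).IsRun N b fun j v => (x j v, K j v) := by
    intro j v
    dsimp only
    by_cases h : (slotProtocol Δ B α).level (N.ident v) ≤ j
    · rw [if_pos h, hx j v, hK j v, if_pos (by exact h), if_pos (by exact h)]
      rfl
    · rw [if_neg h, hx j v, hK j v, if_neg (by exact h), if_neg (by exact h)]
      simp only [slotProtocol, Set.image_image, Set.biUnion_image]
  rw [StagedProtocol.output_eq _ N b hrun hT le_rfl]
  obtain ⟨k1, k2, k3⟩ := hx.slot_congr hK 0 v
  have hslot : ∀ (β : ℕ → ℕ) (b' : V → ℕ), (∀ i c, (i, c) ∈ K 0 v → β i =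
      Function.extend N.ident b' 1 i) → (x 0 v).slot β =
        greedy G Δ (slotRank Δ B (rankColor Δ B x) b') (B * numColors Δ) v := by
    intro β b' hβ
    have h3 := (hx.slot_eq (Function.extend N.ident b' 1) le_rfl v).2
    rw [Nat.sub_self] at h3
    rw [k3 β _ hβ, h3, Function.extend_comp N.ident_injective]
  have hb := hslot (lookup (K 0 v)) b fun i c h => lookup_eq N.ident_injective k1 h
  -- Changing the own bid leaves the set of known identifiers as it is, so the same information
  -- determines the slot under the deviation.
  have hu : ∀ y, (x 0 v).slot (Function.update (lookup (K 0 v)) (N.ident v) y) =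
      greedy G Δ (slotRank Δ B (rankColor Δ B x) (Function.update b v y)) (B * numColors Δ) v := by
    intro y
    refine hslot _ _ fun i c h => ?_
    obtain ⟨w, rfl, -⟩ := k1 _ _ h
    rw [N.ident_injective.extend_apply]
    rcases eq_or_ne w v with rfl | hw
    · simp
    · rw [Function.update_of_ne (N.ident_injective.ne hw), Function.update_of_ne hw,
        lookup_eq N.ident_injective k1 h, N.ident_injective.extend_apply]
  simp only [slotProtocol, SlotMechanism.ofAllocation, hx.ident_eq, hb, hu]

end Mechanism

/-! ### Running time and the main theorem -/

/-- The local algorithm that stops immediately with a fixed output. -/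
def constantAlgorithm {In Out : Type} (o : Out) : LocalAlgorithm In Out where
  State := Unit
  Msg := Unit
  init _ _ := ()
  send _ _ := ()
  receive s _ := s
  output _ := some o

lemma level_le {Δ B K n i : ℕ} (hΔ : 1 ≤ Δ) (hB : 1 ≤ B) (hi : i ≤ K * n ^ K) :
    numStages Δ B + recolorLevel (Nat.clog 2 Δ) i ≤ (70 + K) * (Δ * B + logStar n) := by
  have h1 : recolorLevel (Nat.clog 2 Δ) i ≤ logStar n + K + 3 :=
    recolorLevel_le_iff.2 ((hi.trans (poly_le_tower K n)).trans_lt (tower_lt_palette _ _))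
  have h2 : 2 ^ Nat.clog 2 Δ ≤ 2 * Δ := by
    rcases hΔ.eq_or_lt with h | h
    · subst h; simp
    · have := Nat.pow_pred_clog_lt_self (b := 2) (by norm_num) h
      have hpos : 0 < Nat.clog 2 Δ := Nat.clog_pos (by norm_num) h
      calc 2 ^ Nat.clog 2 Δ = 2 * 2 ^ (Nat.clog 2 Δ - 1) := by
            rw [← pow_succ']; congr 1; omega
        _ ≤ 2 * Δ := Nat.mul_le_mul_left 2 this.le
  have h3 : numColors Δ ≤ 64 * Δ := by
    rw [numColors, pow_add]; omega
  have h4 : B * numColors Δ ≤ 64 * (Δ * B) :=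
    calc B * numColors Δ ≤ B * (64 * Δ) := Nat.mul_le_mul_left B h3
      _ = 64 * (Δ * B) := by ring
  have h5 : Δ ≤ Δ * B := Nat.le_mul_of_pos_right Δ hB
  have h6 : K * 1 ≤ K * (Δ * B + logStar n) := Nat.mul_le_mul_left K (by omega)
  -- The constant is 64 + 2 + 4: greedy turns, settling rounds, and the additive terms `1` and `3`,
  -- absorbed since `Δ * B` is at least `1`.
  rw [numStages, add_mul]
  omega

theorem theorem7p1 :
    ∃ (A : (Δ B : ℕ) → (Fin (Δ + 1) → ℝ) → LocalAlgorithm ℕ (Fin (Δ + 1) × ℝ)) (C : ℕ),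
      ∀ K : ℕ, ∃ C' : ℕ,
        ∀ (Δ B : ℕ) (α : Fin (Δ + 1) → ℝ), Monotone α → (∀ j, 0 ≤ α j) →
        ∀ (V : Type) [Fintype V] [DecidableEq V] (G : SimpleGraph V) [DecidableRel G.Adj],
          (∀ v, G.degree v ≤ Δ) →
          ∀ N : Network G, (∀ v, N.ident v ≤ K * Fintype.card V ^ K) →
            ∃ M : SlotMechanism V Δ,
              M.ComputedBy B (A Δ B α) N (C' * (Δ * B + logStar (Fintype.card V))) ∧
              M.IncentiveCompatible B α ∧
              M.MonotoneAllocation B ∧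
              M.ThresholdPayments B α ∧
              ∀ w, ValidBids B w →
                FeasibleSlots G (M.slot w) ∧
                ∀ o : V → Fin (Δ + 1), FeasibleSlots G o →
                  welfare α w o ≤ (C * max 1 Δ : ℕ) * welfare α w (M.slot w) := by
  classical
  -- For `Δ = 0` a single node must stop in `0` rounds, while the protocol would take at least
  -- `numStages 0 B` stages; with one slot the output is constant anyway.
  refine ⟨fun Δ B α => if Δ = 0 then constantAlgorithm (0, thresholdPayment B α (fun _ => 0) 0)
    else (slotProtocol Δ B α).toLocal, 2, fun K => ⟨70 + K, ?_⟩⟩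
  intro Δ B α hα h0 V _ _ G _ hΔ N hN
  rcases Nat.eq_zero_or_pos Δ with rfl | hpos
  · simp only [if_true]
    have hmon : (SlotMechanism.ofAllocation B α fun (_ : V → ℕ) _ => 0).MonotoneAllocation B :=
      fun _ _ _ _ _ _ _ _ => le_rfl
    refine ⟨SlotMechanism.ofAllocation B α fun _ _ => 0, fun _ _ _ => rfl,
      SlotMechanism.incentiveCompatible_ofAllocation B hα h0 hmon, hmon,
      SlotMechanism.thresholdPayments_ofAllocation B α _, fun w _ => ⟨fun u v huv => ?_,
      fun o _ => ?_⟩⟩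
    · have h1 := (G.degree_pos_iff_exists_adj u).2 ⟨v, huv⟩
      have h2 := hΔ u
      omega
    · have h1 : o = fun _ => 0 := funext fun v => Fin.ext (by omega)
      have h2 : 0 ≤ welfare α w fun _ => 0 :=
        Finset.sum_nonneg fun v _ => mul_nonneg (h0 _) (Nat.cast_nonneg _)
      rw [h1]
      simp only [SlotMechanism.ofAllocation]
      norm_num
      linarith
  simp only [hpos.ne', if_false]
  rcases Nat.eq_zero_or_pos B with rfl | hB
  · have hB : ∀ (b : V → ℕ), ValidBids 0 b → V → False := fun b hb v => by simpa using hb v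
    refine ⟨SlotMechanism.ofAllocation 0 α fun _ _ => 0, fun b hb v => (hB b hb v).elim,
      fun b hb v => (hB b hb v).elim, fun b hb v => (hB b hb v).elim,
      SlotMechanism.thresholdPayments_ofAllocation 0 α _, fun w hw => ?_⟩
    have : IsEmpty V := ⟨hB w hw⟩
    exact ⟨fun u => isEmptyElim u, fun o _ => by simp [welfare]⟩
  obtain ⟨χ, hχ, hp, hcomp⟩ := exists_computedBy (B := B) α hΔ N fun v =>
    level_le hpos hB (hN v)
  have hrank : ∀ b, ValidBids B b → ∀ v, slotRank Δ B χ b v < B * numColors Δ := by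
    intro b hb v
    have h1 := Finset.mem_Icc.1 (hb v)
    have h2 := hχ v
    calc slotRank Δ B χ b v < (B - b v) * numColors Δ + numColors Δ := Nat.add_lt_add_left h2 _
      _ = (B - b v + 1) * numColors Δ := (Nat.succ_mul _ _).symm
      -- Bids are at least `1`, so every agent has its turn and the default slot is never used.
      _ ≤ B * numColors Δ := Nat.mul_le_mul_right _ (by omega)
  have hslot : ∀ b, ValidBids B b → ∀ v,
      (greedy G Δ (slotRank Δ B χ b) (B * numColors Δ) v).getD 0 =
        greedySlot G Δ (slotRank Δ B χ b) v := by
    intro b hb v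
    rw [greedy_eq (hrank b hb v), Option.getD_some]
  have hupd : ∀ b : V → ℕ, ValidBids B b → ∀ v, ∀ x ∈ Finset.Icc 1 B,
      ValidBids B (Function.update b v x) := by
    intro b hb v x hx u
    rcases eq_or_ne u v with rfl | hu
    · rwa [Function.update_self]
    · rw [Function.update_of_ne hu]
      exact hb u
  -- Ranks are two-digit numbers with leading digit `B - b v` and last digit the colour, so an
  -- earlier rank means a bid at least as high.
  have hle : ∀ {c d : ℕ}, c < numColors Δ → d < numColors Δ → ∀ {a b : ℕ},
      a * numColors Δ + c < b * numColors Δ + d → a ≤ b := by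
    intro c d hc hd a b h
    by_contra hab
    have := Nat.mul_le_mul_right (numColors Δ) (Nat.succ_le_of_lt (not_le.1 hab))
    rw [Nat.succ_mul] at this
    omega
  have hmon : (SlotMechanism.ofAllocation B α fun (b : V → ℕ) (v : V) =>
      (greedy G Δ (slotRank Δ B χ b) (B * numColors Δ) v).getD 0).MonotoneAllocation B := by
    intro b hb v x hx y hy hxy
    simp only [SlotMechanism.ofAllocation]
    rw [hslot _ (hupd b hb v x hx), hslot _ (hupd b hb v y hy)]
    refine greedySlot_mono ?_ fun u hu => ?_
    · simp only [slotRank, Function.update_self]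
      exact Nat.add_le_add_right (Nat.mul_le_mul_right _ (by omega)) _
    · simp only [slotRank, Function.update_of_ne hu]
  refine ⟨_, hcomp, SlotMechanism.incentiveCompatible_ofAllocation B hα h0 hmon, hmon,
      SlotMechanism.thresholdPayments_ofAllocation B α _, fun w hw => ?_⟩
  have hs : (SlotMechanism.ofAllocation B α fun (b : V → ℕ) (v : V) =>
      (greedy G Δ (slotRank Δ B χ b) (B * numColors Δ) v).getD 0).slot w =
        greedySlot G Δ (slotRank Δ B χ w) := funext (hslot w hw)
  rw [hs]
  refine ⟨fun u v huv => ?_, fun o _ => ?_⟩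
  · rcases lt_trichotomy (slotRank Δ B χ w u) (slotRank Δ B χ w v) with h | h | h
    · exact greedySlot_ne (hΔ v) huv.symm h
    · exfalso
      -- Equal ranks would have equal last digits, that is, neighbours of equal colour.
      have hmod := congrArg (· % numColors Δ) h
      simp only [slotRank, Nat.mul_add_mod_self_right, Nat.mod_eq_of_lt (hχ _)] at hmod
      exact hp u v huv hmod
    · exact (greedySlot_ne (hΔ u) huv h).symm
  · have h1 := welfare_le_greedySlot (r := slotRank Δ B χ w) hΔ hα h0 (w := w)
      (fun u v _ h => by
        have h1 := hle (hχ u) (hχ v) h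
        have h2 := Finset.mem_Icc.1 (hw u)
        have h3 := Finset.mem_Icc.1 (hw v)
        omega) o
    have h2 : 0 ≤ welfare α w (greedySlot G Δ (slotRank Δ B χ w)) :=
      Finset.sum_nonneg fun v _ => mul_nonneg (h0 _) (Nat.cast_nonneg _)
    refine h1.trans (mul_le_mul_of_nonneg_right ?_ h2)
    -- The factor `2` comes from Δ + 1 ≤ 2Δ.
    rw [max_eq_right (show 1 ≤ Δ from hpos)]
    have : (1 : ℝ) ≤ Δ := Nat.one_le_cast.2 hpos
    push_cast
    linarith
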